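/- Let $n\ge 0$ be an integer, let $\eta=\mathrm{diag}(\sigma_0,\dots,\sigma_n)$ with $\sigma_A\in\{1,-1\}$ be a flat pseudo-Euclidean metric of arbitrary signature on $\mathbb R^{n+1}$, let $\epsilon\in\{1,-1\}$ and $H>0$, and let $$\Sigma_n=\{y\in\mathbb R^{n+1} : y^2:=\eta_{AB}\,y^Ay^B=-\epsilon H^{-2}\}$$ be the pseudo-sphere, with the pseudo-Riemannian metric induced by $\eta$. (This covers de Sitter space: $\epsilon=1$, signature $(1,n)$; anti-de Sitter space: $\epsilon=-1$, signature $(2,n-1)$; and the Euclidean sphere: $\epsilon=-1$, signature $(n+1,0)$.) On a pseudo-Riemannian manifold of dimension $d$ let $*$ be the Hodge operator, $\beta\wedge *\alpha=(\beta,\alpha)_g\,\omega$ with $\omega$ the volume form, let $\delta\alpha=(-1)^{p}*^{-1}d*\alpha$ for a $p$-form $\alpha$, and let $\square=-(d\delta+\delta d)$ be the Laplace-de Rham operator (it does not depend on the orientation). Write $\square_{n+1}$ for this operator on $(\mathbb R^{n+1},\eta)$ and $\square_\Sigma$ for this operator on $\Sigma_n$. For a form $\alpha$ defined near points of $\Sigma_n$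 let $\alpha_\Sigma=l^*\alpha$ be its pull-back by the inclusion $l:\Sigma_n\to\mathbb R^{n+1}$. Let $D=y^A\partial_A$ be the dilation vector field, $i_D$ the interior product by $D$, and $\mathcal L_D=i_Dd+di_D$ the Lie derivative along $D$. Then for every smooth one-form $a$ on an open set $W\subseteq\mathbb R^{n+1}$ (for instance $W=\mathbb R^{n+1}$), at all points of $\Sigma_n\cap W$, $$(\square_{n+1}a)_\Sigma=\square_\Sigma a_\Sigma-\epsilon H^2\left[\mathcal L_D^2a+(n-3)\,\mathcal L_Da+2\,d(i_Da)\right]_\Sigma .$$ This is an identity of one-forms on $\Sigma_n$ that involves no frame; equivalently, it holds in every system of local coordinates of $\Sigma_n$. -/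

import Mathlib

open scoped ContDiff

noncomputable section

namespace DeRham

/-- The coordinate space of dimension `d` (only its smooth structure is used). -/
abbrev Coord (d : ℕ) : Type := Fin d → ℝ

/-- Values of `p`-forms: alternating `p`-linear functions of `d`-dimensional vectors. -/
abbrev Alt (d p : ℕ) : Type := Coord d [⋀^Fin p]→L[ℝ] ℝ

/-- Differential `p`-forms in `d` coordinates (smooth on whatever open set is of interest). The
exterior derivative is Mathlib's `extDeriv`. -/
abbrev Form (d p : ℕ) : Type := Coord d → Alt d p

/-- A metric in `d` coordinates: `g x i j = g_x(∂_i, ∂_j)`. -/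
abbrev Metric (d : ℕ) : Type := Coord d → Matrix (Fin d) (Fin d) ℝ

/-- The coordinate vector `∂_i`. -/
def basisVec {d : ℕ} (i : Fin d) : Coord d := Pi.single i 1

/-- Pull-back `ψ^* α` of a `p`-form. -/
def pullback {m d p : ℕ} (ψ : Coord m → Coord d) (α : Form d p) : Form m p :=
  fun u => (α (ψ u)).compContinuousLinearMap (fderiv ℝ ψ u)

/-- Pull-back `ψ^* g` of a metric: `(ψ^* g)_{ij} = g(∂_i ψ, ∂_j ψ)`. -/
def pullbackMetric {m d : ℕ} (ψ : Coord m → Coord d) (g : Metric d) : Metric m :=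
  fun u => Matrix.of fun i j =>
    (fderiv ℝ ψ u (basisVec i)) ⬝ᵥ ((g (ψ u)).mulVec (fderiv ℝ ψ u (basisVec j)))

/-- Interior product `i_X α = α(X, ·, …, ·)`. -/
def interiorProd {d p : ℕ} (X : Coord d → Coord d) (α : Form d (p + 1)) : Form d p :=
  fun x => (α x).curryLeft (X x)

/-- Lie derivative of a form of positive degree, `L_X = i_X d + d i_X`. -/
def lieDeriv {d p : ℕ} (X : Coord d → Coord d) (α : Form d (p + 1)) : Form d (p + 1) :=
  interiorProd X (extDeriv α) + extDeriv (interiorProd X α)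

/-- The determinant `dx^1 ∧ ⋯ ∧ dx^d`. -/
def detForm (d : ℕ) : Alt d d :=
  { (Matrix.detRowAlternating : Coord d [⋀^Fin d]→ₗ[ℝ] ℝ) with
    cont := Continuous.matrix_det continuous_id }

/-- The volume form `ω = √|det g| dx^1 ∧ ⋯ ∧ dx^d`. -/
def volForm {d : ℕ} (g : Metric d) : Form d d :=
  fun x => Real.sqrt |(g x).det| • detForm d

theorem append_update {d p q : ℕ} (u : Fin p → Coord d) (v : Fin q → Coord d) (i : Fin q)
    (z : Coord d) : Fin.append u (Function.update v i z)
      = Function.update (Fin.append u v) (Fin.natAdd p i) z := by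
  funext k
  refine Fin.addCases (fun j => ?_) (fun j => ?_) k
  · have h : Fin.castAdd q j ≠ Fin.natAdd p i := by
      intro h
      have := congrArg Fin.val h
      simp at this
      omega
    rw [Function.update_of_ne h]
    simp
  · by_cases h : j = i
    · subst h
      simp
    · have h' : Fin.natAdd p j ≠ Fin.natAdd p i := by simpa using h
      rw [Function.update_of_ne h']
      simp [h]

/-- The contraction `w(u_1, …, u_p, ·, …, ·)` of a form of degree `p + q = d`. -/
def contract {d p q : ℕ} (h : p + q = d) (w : Alt d d) (u : Fin p → Coord d) : Alt d q where
  toFun v := w (fun k => Fin.append u v (Fin.cast h.symm k))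
  map_update_add' := by
    subst h
    intro inst v i x y
    obtain rfl : inst = instDecidableEqFin q := Subsingleton.elim _ _
    simp [append_update]
  map_update_smul' := by
    subst h
    intro inst v i c x
    obtain rfl : inst = instDecidableEqFin q := Subsingleton.elim _ _
    simp [append_update]
  map_eq_zero_of_eq' := by
    subst h
    intro v i j hv hij
    refine w.map_eq_zero_of_eq _ (i := Fin.natAdd p i) (j := Fin.natAdd p j) ?_ ?_
    · simpa using hv
    · simpa using hij
  cont := by
    subst h
    refine w.cont.comp (continuous_pi fun k => ?_)
    refine Fin.addCases (fun i => ?_) (fun i => ?_) k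
    · simpa using continuous_const
    · simpa using continuous_apply i

/-- The Hodge operator on `p`-forms, `p + q = d`:
`(*α)(v_1, …, v_q) = (1/p!) ∑ α^{i_1 … i_p} ω(∂_{i_1}, …, ∂_{i_p}, v_1, …, v_q)`, with the indices of
`α` raised by the inverse metric: `α^{i_1 … i_p} = α(g^{i_1 j} ∂_j, …, g^{i_p j} ∂_j)`. This is the
operator such that `β ∧ *α = (β, α)_g ω` for all `p`-forms `β`. -/
def hodge {d p q : ℕ} (g : Metric d) (h : p + q = d) (α : Form d p) : Form d q :=
  fun x => ((p.factorial : ℝ)⁻¹) •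
    ∑ i : Fin p → Fin d, (α x (fun k => (g x)⁻¹ (i k))) •
      contract h (volForm g x) (fun k => basisVec (i k))

/-- The inverse of the Hodge operator `*` (from `p`-forms to `q`-forms, `p + q = d`), taking a
`q`-form to a `p`-form: `*⁻¹ = sgn(g) (-1)^{q(d+1)} *`, where `sgn(g)` is the sign of `det g`. -/
def hodgeInv {d p q : ℕ} (g : Metric d) (h : p + q = d) (β : Form d q) : Form d p :=
  fun x => (SignType.sign (g x).det : ℝ) • (-1 : ℝ) ^ (q * (d + 1)) •
    hodge g ((Nat.add_comm q p).trans h) β x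

/-- The co-differential `δα = (-1)^{deg α} *⁻¹ d * α` on forms of positive degree `p + 1` (there are no
nonzero forms of degree `p + 1 > d`). -/
def codiff {d p : ℕ} (g : Metric d) (α : Form d (p + 1)) : Form d p :=
  if h : p + 1 ≤ d then
    (-1 : ℝ) ^ (p + 1) •
      hodgeInv (q := (d - (p + 1)) + 1) g (by omega)
        (extDeriv (hodge (q := d - (p + 1)) g (by omega) α))
  else 0

/-- The Laplace-de Rham operator `□ = -(dδ + δd)` of the metric `g` on forms of positive degree. -/
def laplaceDeRham {d p : ℕ} (g : Metric d) (α : Form d (p + 1)) : Form d (p + 1) :=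
  -(extDeriv (codiff g α) + codiff g (extDeriv α))

/-- The constant metric `η = diag(σ_0, …, σ_n)`. -/
def flatMetric {d : ℕ} (σ : Fin d → ℝ) : Metric d := fun _ => Matrix.diagonal σ

/-- The dilation vector field `D = y^A ∂_A`. -/
def dilation {d : ℕ} : Coord d → Coord d := fun y => y

/-- The pseudo-sphere `y^A y_A = -ε H⁻²`. -/
def pseudoSphere {d : ℕ} (σ : Fin d → ℝ) (ε H : ℝ) : Set (Coord d) :=
  {y | ∑ A, σ A * y A ^ 2 = -ε * H⁻¹ ^ 2}

/-- `ψ : U → Σ_n ⊂ ℝ^{n+1}` is a smooth immersion of an open set `U ⊂ ℝ^n` into the pseudo-sphere.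
As `Σ_n` has dimension `n`, such a `ψ` is locally the inverse of a coordinate chart of `Σ_n`, and all
inverses of coordinate charts of `Σ_n` are of this form. -/
structure IsLocalParametrization {n : ℕ} (σ : Fin (n + 1) → ℝ) (ε H : ℝ)
    (U : Set (Coord n)) (ψ : Coord n → Coord (n + 1)) : Prop where
  isOpen : IsOpen U
  smooth : ContDiffOn ℝ ∞ ψ U
  mem : ∀ u ∈ U, ψ u ∈ pseudoSphere σ ε H
  immersion : ∀ u ∈ U, Function.Injective (fderiv ℝ ψ u)

/-- Every point of the pseudo-sphere lies in the image of a local parametrization. -/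
theorem exists_isLocalParametrization {n : ℕ} {σ : Fin (n + 1) → ℝ}
    (hσ : ∀ A, σ A = 1 ∨ σ A = -1) {ε H : ℝ} (hε : ε = 1 ∨ ε = -1) (hH : 0 < H)
    {y : Coord (n + 1)} (hy : y ∈ pseudoSphere σ ε H) :
    ∃ (U : Set (Coord n)) (ψ : Coord n → Coord (n + 1)),
      IsLocalParametrization σ ε H U ψ ∧ ∃ u ∈ U, ψ u = y := by
  have hy' : ∑ A, σ A * y A ^ 2 = -ε * H⁻¹ ^ 2 := hy
  obtain ⟨A, hA⟩ : ∃ A, y A ≠ 0 := by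
    by_contra! h
    have h0 : -ε * H⁻¹ ^ 2 = 0 := by rw [← hy']; simp [h]
    have : H⁻¹ ≠ 0 := inv_ne_zero hH.ne'
    rcases hε with rfl | rfl <;> simp [hH.ne'] at h0
  have hσA : σ A * σ A = 1 := by rcases hσ A with h | h <;> rw [h] <;> norm_num
  obtain ⟨s, hs, hsy⟩ : ∃ s : ℝ, s * s = 1 ∧ s * |y A| = y A := by
    rcases lt_or_gt_of_ne hA with h | h
    · exact ⟨-1, by norm_num, by rw [abs_of_neg h]; ring⟩
    · exact ⟨1, by norm_num, by rw [abs_of_pos h]; ring⟩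
  let r : Coord n → ℝ := fun u => σ A * (-ε * H⁻¹ ^ 2 - ∑ j, σ (A.succAbove j) * u j ^ 2)
  have hr : ContDiff ℝ ∞ r := by fun_prop
  let ψ : Coord n → Coord (n + 1) := fun u =>
    A.insertNth (α := fun _ => ℝ) (s * Real.sqrt (r u)) u
  have hψA : ∀ u, ψ u A = s * Real.sqrt (r u) := fun u => by simp [ψ]
  have hψj : ∀ u j, ψ u (A.succAbove j) = u j := fun u j => by simp [ψ]
  have hU : IsOpen {u | 0 < r u} := isOpen_lt continuous_const hr.continuous
  have hsm : ContDiffOn ℝ ∞ ψ {u | 0 < r u} := by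
    rw [contDiffOn_pi]
    intro B
    rcases Fin.eq_self_or_eq_succAbove A B with rfl | ⟨j, rfl⟩
    · simp only [hψA]
      exact contDiffOn_const.mul (hr.contDiffOn.sqrt fun u hu => ne_of_gt hu)
    · simp only [hψj]
      exact (contDiff_apply ℝ ℝ j).contDiffOn
  refine ⟨{u | 0 < r u}, ψ, ⟨hU, hsm, ?_, ?_⟩, fun j => y (A.succAbove j), ?_, ?_⟩
  · intro u hu
    show ∑ B, σ B * ψ u B ^ 2 = -ε * H⁻¹ ^ 2
    rw [Fin.sum_univ_succAbove _ A]
    simp only [hψA, hψj]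
    have h1 : Real.sqrt (r u) ^ 2 = r u := Real.sq_sqrt (le_of_lt hu)
    have h2 : σ A * r u = -ε * H⁻¹ ^ 2 - ∑ j, σ (A.succAbove j) * u j ^ 2 := by
      simp only [r]
      rw [← mul_assoc, hσA, one_mul]
    have h3 : σ A * (s * Real.sqrt (r u)) ^ 2 = σ A * r u := by
      rw [mul_pow, h1, sq s, hs, one_mul]
    rw [h3, h2]
    ring
  · intro u hu
    have hd : DifferentiableAt ℝ ψ u :=
      (hsm.contDiffAt (hU.mem_nhds hu)).differentiableAt (by simp)
    intro v w hvw
    funext j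
    have key : ∀ z, fderiv ℝ ψ u z (A.succAbove j) = z j := by
      intro z
      have h1 := (hasFDerivAt_pi'.1 hd.hasFDerivAt) (A.succAbove j)
      have h2 : HasFDerivAt (fun u => ψ u (A.succAbove j))
          (ContinuousLinearMap.proj (R := ℝ) (φ := fun _ : Fin n => ℝ) j) u := by
        simp only [hψj]
        exact hasFDerivAt_apply j u
      have := congrArg (fun L => L z) (h1.unique h2)
      simpa using this
    rw [← key v, ← key w, hvw]
  all_goals
    have h4 : r (fun j => y (A.succAbove j)) = y A ^ 2 := by
      have h5 : -ε * H⁻¹ ^ 2 - ∑ j, σ (A.succAbove j) * y (A.succAbove j) ^ 2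
          = σ A * y A ^ 2 := by
        rw [← hy', Fin.sum_univ_succAbove _ A]
        ring
      simp only [r]
      rw [h5, ← mul_assoc, hσA, one_mul]
  · show 0 < r _
    rw [h4]
    positivity
  · funext B
    rcases Fin.eq_self_or_eq_succAbove A B with rfl | ⟨j, rfl⟩
    · rw [hψA, h4, Real.sqrt_sq_eq_abs, hsy]
    · rw [hψj]

end DeRham

end

/-!
The point is that the codifferential of the pseudo-sphere `Σ` acts on pulled-back forms through an
operator of the ambient space. For a form `F` of degree `p + 1`,

  `δ_Σ F_Σ = (δF - ε H² (i_D d i_D F + (n - 2p - 1) i_D F))_Σ`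

(`IsLocalParametrization.codiff_pullback`). As `d` commutes with pull-backs, this formula for `a`
and for `da` determines `□_Σ a_Σ = -(dδ + δd) a_Σ`. The terms with `D` add up to
`L_D² a + (n - 3) L_D a + 2 d i_D a`, because `L_D² = i_D d i_D d + d i_D d i_D` (`lieDeriv_lieDeriv`).

The formula for `δ_Σ` rests on the expression of the codifferential as a divergence,
`(δα)^{i_1 … i_p} = -|g|^{-1/2} ∂_i (√|g| α^{i i_1 … i_p})` (`codiff_eq_neg`), valid for every
nondegenerate metric. It follows from `*⁻¹ * = 1` (`hodgeInv_hodge`) and from `d * α = ± * β` with `β` the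
divergence of `α` (`extDeriv_hodge`). The latter holds because forms of degree `d + 1` vanish in
dimension `d` (`sum_removeNth_contract`).

On the pseudo-sphere the components of `F_Σ` with raised indices are the values of `F` on the
frame `E^i = g^{ij} ∂_j ψ`. The position vector `ψ` is normal to `Σ`, with `η(ψ, ψ) = -ε H⁻²`,
which gives `∂_k E^i = -Γ^i_{jk} E^j + ε H² δ^i_k ψ` (`fderiv_dualFrame`). In the divergence the
Christoffel symbols cancel: their trace against the derivative of `√|g|` (`fderiv_sqrt_abs_det`),
the others by symmetry (`sum_apply_update_fderiv_dualFrame`). The normal parts contribute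
`(n - p) ε H² i_D F`. The derivative of `F` is contracted with `∂_i ψ ⊗ E^i`, which is the inverse
of `η` plus `ε H² ψ ⊗ ψ` (`sum_bilinear`); the latter term gives `ε H² i_D ∂_D F`, and
`i_D ∂_D F = i_D d i_D F - (p + 1) i_D F` (`interiorProd_extDeriv_interiorProd`).
-/

noncomputable section

open scoped Topology

namespace DeRham

/-! ### Contractions of alternating forms and the inverse of the Hodge operator -/

theorem contract_apply {d p q : ℕ} (h : p + q = d) (w : Alt d d) (u : Fin p → Coord d)
    (v : Fin q → Coord d) :
    contract h w u v = w (fun k => Fin.append u v (Fin.cast h.symm k)) := rfl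

theorem contract_smul {d p q : ℕ} (h : p + q = d) (c : ℝ) (w : Alt d d) (u : Fin p → Coord d) :
    contract h (c • w) u = c • contract h w u := rfl

theorem coe_finRotate_pow {m : ℕ} (k : ℕ) (i : Fin m) :
    (((finRotate m) ^ k) i : ℕ) = (i + k) % m := by
  rcases m with _ | m
  · exact i.elim0
  induction k with
  | zero => simp [Nat.mod_eq_of_lt i.isLt]
  | succ k ih =>
    rw [pow_succ', Equiv.Perm.mul_apply, finRotate_apply, Fin.val_add, ih]
    simp [add_assoc]

/-- Exchanging a block of `p` vectors with a block of `q` vectors costs the sign `(-1)^{pq}`. -/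
theorem contract_swap {d p q : ℕ} (h : p + q = d) (w : Alt d d) (u : Fin p → Coord d)
    (v : Fin q → Coord d) :
    contract h w u v = (-1) ^ (p * q) * contract ((Nat.add_comm q p).trans h) w v u := by
  subst h
  -- exchanging the two blocks is the `q`-th power of the cyclic rotation, of sign `(-1)^{pq}`
  have hperm : (fun k => Fin.append v u (Fin.cast (Nat.add_comm p q) k)) ∘
      ((finRotate (p + q)) ^ q) = Fin.append u v := by
    funext k
    refine Fin.addCases (fun i => ?_) (fun i => ?_) k
    · have : Fin.cast (Nat.add_comm p q) (((finRotate (p + q)) ^ q) (Fin.castAdd q i))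
          = Fin.natAdd q i := by
        ext
        simp only [Fin.val_cast, coe_finRotate_pow, Fin.val_castAdd, Fin.val_natAdd]
        rw [Nat.mod_eq_of_lt (by omega), add_comm]
      simp only [Function.comp_apply, this, Fin.append_right, Fin.append_left]
    · have : Fin.cast (Nat.add_comm p q) (((finRotate (p + q)) ^ q) (Fin.natAdd p i))
          = Fin.castAdd p i := by
        ext
        simp only [Fin.val_cast, coe_finRotate_pow, Fin.val_castAdd, Fin.val_natAdd]
        rw [show p + (i : ℕ) + q = i + (p + q) by omega, Nat.add_mod_right,
          Nat.mod_eq_of_lt (by omega)]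
      simp only [Function.comp_apply, this, Fin.append_right, Fin.append_left]
  have hsign' : ((Equiv.Perm.sign ((finRotate (p + q)) ^ q) : ℤ) : ℝ) = (-1) ^ (p * q) := by
    rw [map_pow, sign_finRotate]
    push_cast
    rcases q with _ | q
    · simp
    · rw [← pow_mul]
      have h1 : (p + (q + 1) - 1) * (q + 1) = p * (q + 1) + q * (q + 1) := by
        rw [show p + (q + 1) - 1 = p + q by omega]
        ring
      rw [h1, pow_add, (Nat.even_mul_succ_self q).neg_one_pow, mul_one]
  rw [contract_apply, contract_apply, ← hsign']
  have := w.toAlternatingMap.map_perm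
    (fun k => Fin.append v u (Fin.cast (Nat.add_comm p q) k)) ((finRotate (p + q)) ^ q)
  rw [hperm, Units.smul_def, zsmul_eq_mul] at this
  exact this

theorem eq_sum_basisVec {d : ℕ} (v : Coord d) : v = ∑ j, v j • (basisVec j : Coord d) :=
  (pi_eq_sum_univ' v).trans (by simp [basisVec])

theorem alt_apply_eq_sum {d p : ℕ} (A : Alt d p) (v : Fin p → Coord d) :
    A v = ∑ L : Fin p → Fin d, (∏ k, v k (L k)) * A (fun k => basisVec (L k)) := by
  have h : v = fun k => ∑ j, v k j • (basisVec j : Coord d) :=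
    funext fun k => eq_sum_basisVec (v k)
  conv_lhs => rw [h]
  have h2 := A.toMultilinearMap.map_sum (fun k j => v k j • (basisVec j : Coord d))
  refine h2.trans (Finset.sum_congr rfl fun L _ => ?_)
  exact A.toMultilinearMap.map_smul_univ (fun k => v k (L k)) (fun k => basisVec (L k))

/-- The full contraction of two `p`-forms does not change if the basis is replaced by the rows of
`M` in one of them and by the dual basis, the rows of `N = (Mᵀ)⁻¹`, in the other. -/
theorem sum_rows_mul_rows {d p : ℕ} (A B : Alt d p) {M N : Matrix (Fin d) (Fin d) ℝ}
    (hMN : M.transpose * N = 1) :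
    ∑ I : Fin p → Fin d, A (fun k => M (I k)) * B (fun k => N (I k)) =
      ∑ I : Fin p → Fin d, A (fun k => basisVec (I k)) * B (fun k => basisVec (I k)) := by
  have key : ∀ L L' : Fin p → Fin d,
      ∑ I : Fin p → Fin d, (∏ k, M (I k) (L k)) * ∏ k, N (I k) (L' k)
        = if L = L' then 1 else 0 := by
    intro L L'
    have h1 : ∀ k, ∑ i, M i (L k) * N i (L' k) = if L k = L' k then 1 else 0 := by
      intro k
      have := congrFun (congrFun hMN (L k)) (L' k)
      simpa [Matrix.mul_apply, Matrix.one_apply] using this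
    simp_rw [← Finset.prod_mul_distrib]
    rw [← Fintype.prod_sum (fun k i => M i (L k) * N i (L' k))]
    simp_rw [h1]
    rw [Finset.prod_ite_zero]
    simp [funext_iff]
  simp_rw [alt_apply_eq_sum A (fun k => M _), alt_apply_eq_sum B (fun k => N _),
    Finset.sum_mul_sum]
  rw [Finset.sum_comm]
  refine Finset.sum_congr rfl fun L _ => ?_
  rw [Finset.sum_comm]
  have : ∀ L' : Fin p → Fin d, ∑ I : Fin p → Fin d,
      ((∏ k, M (I k) (L k)) * A fun k => basisVec (L k)) *
        ((∏ k, N (I k) (L' k)) * B fun k => basisVec (L' k))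
      = (if L = L' then 1 else 0) *
        ((A fun k => basisVec (L k)) * B fun k => basisVec (L' k)) := by
    intro L'
    rw [← key, Finset.sum_mul]
    exact Finset.sum_congr rfl fun I _ => by ring
  simp_rw [this]
  simp

/-- If `B` vanishes on every tuple of basis vectors with an index outside the range of `J`, then
only the `q!` rearrangements of `J` contribute to the full contraction of `A` and `B`, all
equally. -/
theorem sum_alt_mul_alt {d q : ℕ} (A B : Alt d q) {J : Fin q → Fin d}
    (hJ : Function.Injective J)
    (hB : ∀ K : Fin q → Fin d, (∃ k, K k ∉ Set.range J) → B (fun k => basisVec (K k)) = 0) :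
    ∑ K : Fin q → Fin d, A (fun k => basisVec (K k)) * B (fun k => basisVec (K k)) =
      q.factorial * (A (fun k => basisVec (J k)) * B (fun k => basisVec (J k))) := by
  have hperm : ∀ τ : Equiv.Perm (Fin q),
      A (fun k => basisVec (J (τ k))) * B (fun k => basisVec (J (τ k)))
        = A (fun k => basisVec (J k)) * B (fun k => basisVec (J k)) := by
    intro τ
    have h1 := A.toAlternatingMap.map_perm (fun k => basisVec (J k)) τ
    have h2 := B.toAlternatingMap.map_perm (fun k => basisVec (J k)) τ
    rw [Units.smul_def, zsmul_eq_mul] at h1 h2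
    have h1' : A (fun k => basisVec (J (τ k))) = _ := h1
    have h2' : B (fun k => basisVec (J (τ k))) = _ := h2
    rw [h1', h2', mul_mul_mul_comm, ← Int.cast_mul, ← Units.val_mul, Int.units_mul_self]
    simp
  rw [← Finset.sum_of_injOn (s := (Finset.univ : Finset (Equiv.Perm (Fin q))))
    (f := fun _ => A (fun k => basisVec (J k)) * B (fun k => basisVec (J k)))
    (fun τ => J ∘ τ) ?_ (fun _ _ => Finset.mem_univ _) ?_ (fun τ _ => (hperm τ).symm)]
  · simp [Fintype.card_perm]
  · intro τ _ τ' _ hττ'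
    ext1 k
    exact hJ (congrFun hττ' k)
  · intro K _ hK
    by_cases h : ∃ k, K k ∉ Set.range J
    · rw [hB K h, mul_zero]
    · -- an injective `K` with values in the range of `J` is a rearrangement of `J`
      push Not at h
      by_cases hinj : Function.Injective K
      · exfalso
        choose f hf using h
        have hf' : Function.Injective f := fun a b hab => hinj (by rw [← hf a, ← hf b, hab])
        exact hK ⟨Equiv.ofBijective f (Finite.injective_iff_bijective.1 hf'),
          Finset.mem_coe.2 (Finset.mem_univ _), funext hf⟩
      · rw [Function.Injective] at hinj
        push Not at hinj
        obtain ⟨a, b, hab, hne⟩ := hinj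
        rw [A.map_eq_zero_of_eq _ (by simp [hab]) hne, zero_mul]

theorem detForm_apply {d : ℕ} (v : Fin d → Coord d) :
    detForm d v = (Matrix.of v).det := rfl

theorem detForm_mulVec {d : ℕ} (M : Matrix (Fin d) (Fin d) ℝ) (v : Fin d → Coord d) :
    detForm d (fun k => M.mulVec (v k)) = M.det * detForm d v := by
  have : Matrix.of (fun k => M.mulVec (v k)) = Matrix.of v * M.transpose := by
    ext i j
    simp [Matrix.mul_apply, Matrix.mulVec, dotProduct, mul_comm]
  rw [detForm_apply, detForm_apply, this, Matrix.det_mul, Matrix.det_transpose, mul_comm]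

theorem contract_detForm_mulVec {d p q : ℕ} (h : p + q = d) (M : Matrix (Fin d) (Fin d) ℝ)
    (u : Fin p → Coord d) (v : Fin q → Coord d) :
    contract h (detForm d) (fun k => M.mulVec (u k)) (fun k => M.mulVec (v k)) =
      M.det * contract h (detForm d) u v := by
  rw [contract_apply, contract_apply, ← detForm_mulVec]
  congr 1
  funext k
  generalize Fin.cast h.symm k = k
  refine Fin.addCases (fun i => ?_) (fun i => ?_) k <;> simp

/-- Alternating forms are determined by their values on the rows of an invertible matrix. -/
theorem alt_ext_rows {d p : ℕ} {A B : Alt d p} {G : Matrix (Fin d) (Fin d) ℝ}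
    (hG : IsUnit G.det)
    (hAB : ∀ I : Fin p → Fin d, Function.Injective I →
      A (fun k => G (I k)) = B (fun k => G (I k))) : A = B := by
  have hrow : ∀ i, G.transpose.mulVec (basisVec i) = G i := by
    intro i
    ext j
    simp [basisVec]
  let T : Coord d →L[ℝ] Coord d := (Matrix.toLin' G.transpose).toContinuousLinearMap
  have hT : ∀ v, T v = G.transpose.mulVec v := fun v => by simp [T]
  have h1 : A.compContinuousLinearMap T = B.compContinuousLinearMap T := by
    apply ContinuousAlternatingMap.toAlternatingMap_injective
    refine Module.Basis.ext_alternating (Pi.basisFun ℝ (Fin d)) fun I hI => ?_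
    have := hAB I hI
    simp_rw [← hrow, ← hT] at this
    simpa [basisVec, Function.comp_def] using this
  ext v
  have hG' : IsUnit G.transpose.det := by rwa [Matrix.det_transpose]
  have h2 := congrArg (fun C => C (fun k => (G.transpose)⁻¹.mulVec (v k))) h1
  simpa [Function.comp_def, hT, Matrix.mulVec_mulVec, Matrix.mul_nonsing_inv _ hG'] using h2

theorem exists_complementary {d p q : ℕ} (h : p + q = d) {I : Fin p → Fin d}
    (hI : Function.Injective I) :
    ∃ J : Fin q → Fin d, Function.Injective J ∧ Set.range J = (Set.range I)ᶜ := by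
  classical
  have hc : Fintype.card ((Set.range I)ᶜ : Set (Fin d)) = q := by
    rw [Fintype.card_compl_set, Set.card_range_of_injective hI]
    simp
    omega
  let e := (Fintype.equivFinOfCardEq hc).symm
  exact ⟨fun k => e k, Subtype.val_injective.comp e.injective, by
    rw [show (fun k => (e k : Fin d)) = Subtype.val ∘ e from rfl, Set.range_comp,
      e.range_eq_univ, Set.image_univ, Subtype.range_coe]⟩

theorem contract_eq_zero_of_eq {d p q : ℕ} (h : p + q = d) (w : Alt d d) {u : Fin p → Coord d}
    {v : Fin q → Coord d} {i : Fin p} {j : Fin q} (hij : u i = v j) : contract h w u v = 0 := by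
  subst h
  refine w.map_eq_zero_of_eq _ (i := Fin.castAdd q i) (j := Fin.natAdd p j) (by simpa using hij) ?_
  intro h
  have := congrArg Fin.val h
  simp at this
  omega

/-- The determinant of complementary sets of basis vectors is `±1`. -/
theorem contract_detForm_sq {d p q : ℕ} (h : p + q = d) {I : Fin p → Fin d} {J : Fin q → Fin d}
    (hI : Function.Injective I) (hJ : Function.Injective J)
    (hIJ : Set.range J = (Set.range I)ᶜ) :
    contract h (detForm d) (fun k => basisVec (I k)) (fun k => basisVec (J k)) *
      contract h (detForm d) (fun k => basisVec (I k)) (fun k => basisVec (J k)) = 1 := by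
  subst h
  have hinj : Function.Injective (Fin.append I J) := by
    rw [Fin.append_injective_iff]
    refine ⟨hI, hJ, fun i j hij => ?_⟩
    have : J j ∈ (Set.range I)ᶜ := hIJ ▸ Set.mem_range_self j
    exact this ⟨i, hij⟩
  let τ := Equiv.ofBijective _ (Finite.injective_iff_bijective.1 hinj)
  have h1 : contract rfl (detForm (p + q)) (fun k => basisVec (I k)) (fun k => basisVec (J k))
      = detForm (p + q) ((fun k => basisVec k) ∘ τ) := by
    rw [contract_apply]
    congr 1
    funext k
    refine Fin.addCases (fun i => ?_) (fun i => ?_) k <;> simp [τ]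
  have h2 : detForm (p + q) (fun k => basisVec k) = 1 := by
    rw [detForm_apply]
    have : Matrix.of (fun k => (basisVec k : Coord (p + q))) = 1 := by
      ext i j
      simp [basisVec, Matrix.one_apply, Pi.single_apply, eq_comm]
    rw [this, Matrix.det_one]
  have h3 := (detForm (p + q)).toAlternatingMap.map_perm (fun k => basisVec k) τ
  rw [Units.smul_def, zsmul_eq_mul] at h3
  have h3' : detForm (p + q) ((fun k => basisVec k) ∘ τ) = _ := h3
  have h2' : (detForm (p + q)).toAlternatingMap (fun k => basisVec k) = 1 := h2
  rw [h1, h3', h2', mul_one, ← Int.cast_mul, ← Units.val_mul, Int.units_mul_self]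
  simp

/-- The vector `g^{ij} ∂_j` metrically dual to the coordinate form `dx^i`. -/
def dualVec {d : ℕ} (g : Metric d) (x : Coord d) (i : Fin d) : Coord d := (g x)⁻¹ i

theorem hodge_apply {d p q : ℕ} (g : Metric d) (h : p + q = d) (α : Form d p) (x : Coord d)
    (v : Fin q → Coord d) :
    hodge g h α x v = (p.factorial : ℝ)⁻¹ * (Real.sqrt |(g x).det| *
      ∑ I : Fin p → Fin d, α x (fun k => dualVec g x (I k)) *
        contract h (detForm d) (fun k => basisVec (I k)) v) := by
  simp only [hodge, volForm, contract_smul, dualVec, ContinuousAlternatingMap.smul_apply,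
    ContinuousAlternatingMap.sum_apply, smul_eq_mul, Finset.mul_sum]
  refine Finset.sum_congr rfl fun I _ => by ring

/-- `*⁻¹ * = 1` for a nondegenerate metric. It suffices to compare both sides on the vectors
`dx^i♯`, `i ∈ I`, where each of the two contractions collapses to the term of the complementary
indices. -/
theorem hodgeInv_hodge {d p q : ℕ} {g : Metric d} (h : p + q = d) (α : Form d p) {x : Coord d}
    (hsymm : (g x).IsSymm) (hdet : (g x).det ≠ 0) :
    hodgeInv g h (hodge g h α) x = α x := by
  have hu : IsUnit (g x).det := isUnit_iff_ne_zero.2 hdet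
  set G := (g x)⁻¹ with hG
  have hGs : G.IsSymm := by
    rw [Matrix.IsSymm, hG, Matrix.transpose_nonsing_inv, hsymm.eq]
  have hGu : IsUnit G.det := by
    rw [hG, Matrix.det_nonsing_inv]
    exact hu.ringInverse
  refine alt_ext_rows hGu fun I hI => ?_
  obtain ⟨J, hJ, hIJ⟩ := exists_complementary h hI
  have hrow : ∀ i, G.mulVec (basisVec i) = G i := by
    intro i
    ext j
    simp [basisVec, hGs.apply]
  have hGg : ∀ i, G.mulVec (g x i) = basisVec i := by
    intro i
    ext j
    have h1 : (G * g x) j i = (1 : Matrix _ _ ℝ) j i := by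
      rw [hG, Matrix.nonsing_inv_mul _ hu]
    rw [Matrix.mul_apply] at h1
    simp only [Matrix.mulVec, dotProduct, basisVec, Pi.single_apply]
    rw [Matrix.one_apply] at h1
    rw [← h1]
    exact Finset.sum_congr rfl fun k _ => by rw [hsymm.apply]
  let T : Coord d →L[ℝ] Coord d := (Matrix.toLin' G).toContinuousLinearMap
  have hT : ∀ v, T v = G.mulVec v := fun v => by simp [T]
  set D := contract h (detForm d) (fun k => basisVec (I k)) (fun k => basisVec (J k)) with hD
  -- the `q`-form `*α` on the vectors complementary to `I`
  have hγ : hodge g h α x (fun k => basisVec (J k))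
      = Real.sqrt |(g x).det| * (α x (fun k => G (I k)) * D) := by
    rw [hodge_apply]
    simp only [dualVec, ← hG]
    have h1 := sum_alt_mul_alt ((α x).compContinuousLinearMap T)
      (contract ((Nat.add_comm q p).trans h) (detForm d) (fun k => basisVec (J k))) hI ?_
    · simp only [ContinuousAlternatingMap.compContinuousLinearMap_apply, Function.comp_def, hT,
        hrow] at h1
      simp_rw [contract_swap h]
      rw [hD, contract_swap h]
      simp_rw [mul_left_comm _ ((-1 : ℝ) ^ (p * q))]
      rw [← Finset.mul_sum, h1]
      have := Nat.factorial_ne_zero p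
      field_simp
    · rintro K ⟨k, hk⟩
      have : K k ∈ Set.range J := by rw [hIJ]; exact hk
      obtain ⟨j, hj⟩ := this
      exact contract_eq_zero_of_eq _ _ (i := j) (j := k) (by rw [hj])
  -- moving the inverse metric from one factor of the contraction to the other produces `det g⁻¹`
  have hsum : ∑ K : Fin q → Fin d, hodge g h α x (fun k => G (K k)) *
        contract ((Nat.add_comm q p).trans h) (detForm d) (fun k => basisVec (K k))
          (fun k => G (I k))
      = (-1) ^ (p * q) *
        (G.det * (q.factorial * (hodge g h α x (fun k => basisVec (J k)) * D))) := by
    have h1 := sum_rows_mul_rows (hodge g h α x)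
      ((contract h (detForm d) (fun k => G (I k))).compContinuousLinearMap T)
      (M := G) (N := g x) (by rw [hGs.eq, hG, Matrix.nonsing_inv_mul _ hu])
    have h2 := sum_alt_mul_alt (hodge g h α x)
      (contract h (detForm d) (fun k => basisVec (I k))) hJ ?_
    · have hB : ∀ K : Fin q → Fin d,
          contract h (detForm d) (fun k => G (I k)) (fun k => T (basisVec (K k))) =
            G.det * contract h (detForm d) (fun k => basisVec (I k)) (fun k => basisVec (K k)) := by
        intro K
        rw [← contract_detForm_mulVec]
        simp only [hrow, hT]
      simp only [ContinuousAlternatingMap.compContinuousLinearMap_apply, Function.comp_def,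
        hB] at h1
      simp only [hT, hGg] at h1
      simp_rw [mul_left_comm _ G.det] at h1
      rw [← Finset.mul_sum, h2] at h1
      rw [hD, ← h1, Finset.mul_sum]
      refine Finset.sum_congr rfl fun K _ => ?_
      rw [contract_swap, mul_comm q p]
      ring
    · rintro K ⟨k, hk⟩
      rw [hIJ, Set.mem_compl_iff, not_not] at hk
      obtain ⟨i, hi⟩ := hk
      exact contract_eq_zero_of_eq _ _ (i := i) (j := k) (by rw [hi])
  have hDD : D * D = 1 := contract_detForm_sq h hI hJ hIJ
  have hsq : Real.sqrt |(g x).det| * Real.sqrt |(g x).det| = |(g x).det| :=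
    Real.mul_self_sqrt (abs_nonneg _)
  have hGdet : G.det * (g x).det = 1 := by
    rw [← Matrix.det_mul, hG, Matrix.nonsing_inv_mul _ hu, Matrix.det_one]
  have hsgn : (SignType.sign (g x).det : ℝ) * |(g x).det| = (g x).det := sign_mul_abs _
  have hpar : (-1 : ℝ) ^ (q * (d + 1)) * (-1) ^ (p * q) = 1 := by
    rw [← pow_add, ← h]
    have : q * (p + q + 1) + p * q = 2 * (p * q) + q * (q + 1) := by ring
    rw [this, pow_add, (even_two_mul _).neg_one_pow, (Nat.even_mul_succ_self q).neg_one_pow,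
      mul_one]
  simp only [hodgeInv, ContinuousAlternatingMap.smul_apply, smul_eq_mul]
  rw [hodge_apply]
  simp only [dualVec, ← hG]
  rw [hsum, hγ]
  have hq := Nat.factorial_ne_zero q
  calc _ = ((-1 : ℝ) ^ (q * (d + 1)) * (-1) ^ (p * q)) * ((q.factorial : ℝ)⁻¹ * q.factorial) *
        (D * D) * (G.det * ((SignType.sign (g x).det : ℝ) *
          (Real.sqrt |(g x).det| * Real.sqrt |(g x).det|))) * α x (fun k => G (I k)) := by ring
    _ = _ := by
      rw [hpar, hDD, hsq, hsgn, hGdet, inv_mul_cancel₀ (by exact_mod_cast hq)]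
      ring

/-! ### The codifferential as a divergence -/

theorem alt_eq_zero_of_lt {d p : ℕ} (h : d < p) (A : Alt d p) : A = 0 := by
  apply ContinuousAlternatingMap.toAlternatingMap_injective
  refine Module.Basis.ext_alternating (Pi.basisFun ℝ (Fin d)) fun I hI => ?_
  have := Fintype.card_le_of_injective I hI
  simp only [Fintype.card_fin] at this
  omega

theorem removeNth_castAdd_append {β : Type*} {p q : ℕ} (u : Fin (p + 1) → β)
    (v : Fin (q + 1) → β) (m : Fin (p + 1)) :
    (Fin.removeNth (n := p + 1 + q) (Fin.castAdd (q + 1) m)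
        (Fin.append u v : Fin (p + 1 + (q + 1)) → β) :
        Fin (p + 1 + q) → β) =
      fun k => Fin.append (m.removeNth u) v (Fin.cast (by omega) k) := by
  funext k
  obtain ⟨k, rfl⟩ : ∃ k' : Fin (p + (q + 1)), Fin.cast (by omega) k' = k :=
    ⟨Fin.cast (by omega) k, rfl⟩
  refine Fin.addCases (fun i => ?_) (fun i => ?_) k
  · have : Fin.succAbove (n := p + 1 + q) (Fin.castAdd (q + 1) m)
        (Fin.cast (by omega) (Fin.castAdd (q + 1) i)) = Fin.castAdd (q + 1) (m.succAbove i) := by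
      ext
      simp [Fin.succAbove, Fin.lt_def]
      split_ifs <;> simp
    rw [Fin.removeNth_apply, this]
    simp [Fin.removeNth_apply]
  · have : Fin.succAbove (n := p + 1 + q) (Fin.castAdd (q + 1) m)
        (Fin.cast (by omega) (Fin.natAdd p i)) = Fin.natAdd (p + 1) i := by
      ext
      have := m.isLt
      simp [Fin.succAbove, Fin.lt_def]
      split_ifs <;> simp <;> omega
    rw [Fin.removeNth_apply, this]
    simp

theorem removeNth_natAdd_append {β : Type*} {p q : ℕ} (u : Fin (p + 1) → β)
    (v : Fin (q + 1) → β) (m : Fin (q + 1)) :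
    (Fin.removeNth (n := p + 1 + q) (Fin.natAdd (p + 1) m)
        (Fin.append u v : Fin (p + 1 + (q + 1)) → β) :
        Fin (p + 1 + q) → β) =
      Fin.append u (m.removeNth v) := by
  funext k
  refine Fin.addCases (fun i => ?_) (fun i => ?_) k
  · have : Fin.succAbove (n := p + 1 + q) (Fin.natAdd (p + 1) m)
        (Fin.castAdd q i) = Fin.castAdd (q + 1) i := by
      ext
      have := i.isLt
      simp [Fin.succAbove, Fin.lt_def]
      split_ifs <;> simp
      omega
    rw [Fin.removeNth_apply, this]
    simp
  · have : Fin.succAbove (n := p + 1 + q) (Fin.natAdd (p + 1) m)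
        (Fin.natAdd (p + 1) i) = Fin.natAdd (p + 1) (m.succAbove i) := by
      ext
      simp [Fin.succAbove, Fin.lt_def]
      split_ifs <;> simp
      omega
    rw [Fin.removeNth_apply, this]
    simp [Fin.removeNth_apply]

/-- The `(d+1)`-form `L ∧ w` vanishes in dimension `d`. Expanded on the vectors `u, v`, this
trades the terms with `L` on a vector of `v` for the terms with `L` on a vector of `u`. -/
theorem sum_removeNth_contract {d p q : ℕ} (h : p + 1 + q = d) (h' : p + (q + 1) = d)
    (w : Alt d d) (L : Coord d →L[ℝ] ℝ) (u : Fin (p + 1) → Coord d) (v : Fin (q + 1) → Coord d) :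
    ∑ k : Fin (q + 1), (-1 : ℝ) ^ (k : ℕ) * (L (v k) * contract h w u (k.removeNth v)) =
      (-1) ^ p * ∑ m : Fin (p + 1),
        (-1 : ℝ) ^ (m : ℕ) * (L (u m) * contract h' w (m.removeNth u) v) := by
  subst h
  have h1 : ContinuousAlternatingMap.alternatizeUncurryFin (L.smulRight w)
      (Fin.append u v : Fin (p + 1 + (q + 1)) → Coord (p + 1 + q)) = 0 := by
    rw [alt_eq_zero_of_lt (Nat.lt_succ_self _) (ContinuousAlternatingMap.alternatizeUncurryFin _)]
    rfl
  rw [ContinuousAlternatingMap.alternatizeUncurryFin_apply] at h1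
  have h2 := (Fin.sum_univ_add (M := ℝ) (a := p + 1) (b := q + 1) (fun k =>
    (-1 : ℤ) ^ (k : ℕ) • (L.smulRight w ((Fin.append u v : Fin (p + 1 + (q + 1)) → _) k)
      (Fin.removeNth (n := p + 1 + q) k
        (Fin.append u v : Fin (p + 1 + (q + 1)) → Coord (p + 1 + q)))))).symm.trans h1
  simp only [removeNth_castAdd_append, removeNth_natAdd_append, Fin.append_left, Fin.append_right,
    Fin.val_castAdd, Fin.val_natAdd, ContinuousLinearMap.smulRight_apply,
    ContinuousAlternatingMap.smul_apply, smul_eq_mul, zsmul_eq_mul, pow_add] at h2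
  push_cast at h2
  have h4 : ∀ k : Fin (q + 1), (-1 : ℝ) ^ p * -1 * (-1) ^ (k : ℕ) *
      (L (v k) * w (Fin.append u (k.removeNth v))) =
      (-1 : ℝ) ^ p * -1 * ((-1) ^ (k : ℕ) * (L (v k) * w (Fin.append u (k.removeNth v)))) :=
    fun k => by ring
  simp_rw [h4, ← Finset.mul_sum] at h2
  have h3 : (-1 : ℝ) ^ p * (-1 : ℝ) ^ p = 1 := by rw [← mul_pow]; simp
  set X := ∑ k : Fin (q + 1),
    (-1 : ℝ) ^ (k : ℕ) * (L (v k) * w (Fin.append u (k.removeNth v))) with hX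
  have hX' : ∑ k : Fin (q + 1), (-1 : ℝ) ^ (k : ℕ) *
      (L (v k) * contract rfl w u (k.removeNth v)) = X := rfl
  have hY : ∀ m : Fin (p + 1), contract h' w (m.removeNth u) v =
    w fun k => Fin.append (m.removeNth u) v (Fin.cast h'.symm k) := fun m => rfl
  rw [hX']
  simp_rw [hY]
  linear_combination (-(-1 : ℝ) ^ p) * h2 + (-X) * h3

theorem alt_insertNth {d p : ℕ} (A : Alt d (p + 1)) (m : Fin (p + 1)) (f : Fin d → Coord d)
    (i : Fin d) (I : Fin p → Fin d) :
    A (fun k => f (m.insertNth (α := fun _ => Fin d) i I k)) =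
      (-1) ^ (m : ℕ) * A (fun k => f (Fin.cons (α := fun _ => Fin d) i I k)) := by
  have h1 := A.toAlternatingMap.map_insertNth m (f i) (fun k => f (I k))
  rw [zsmul_eq_mul] at h1
  push_cast at h1
  refine Eq.trans ?_ (h1.trans ?_)
  · refine congrArg A (funext fun k => ?_)
    refine Fin.succAboveCases m ?_ (fun j => ?_) k <;> simp
  · congr 1
    refine congrArg A (funext fun k => ?_)
    refine Fin.cases ?_ (fun j => ?_) k <;> simp

/-- With `T_I = √|g| α^I`, the exterior derivative of `*α` is, up to sign, the Hodge dual of the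
divergence `|g|^{-1/2} ∂_i T_{i I'}`: by `sum_removeNth_contract` the derivatives along the free
slots turn into derivatives along the slots contracted with `T`, which all contribute equally. -/
theorem extDeriv_hodge {d p q : ℕ} {g : Metric d} (h : p + 1 + q = d) (h' : p + (q + 1) = d)
    {α : Form d (p + 1)} {x : Coord d} {β : Alt d p}
    (hT : ∀ I : Fin (p + 1) → Fin d, DifferentiableAt ℝ
      (fun y => Real.sqrt |(g y).det| * α y (fun k => dualVec g y (I k))) x)
    (hβ : ∀ I : Fin p → Fin d, ∑ i, fderiv ℝ (fun y => Real.sqrt |(g y).det| *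
        α y (fun k => dualVec g y (Fin.cons (α := fun _ => Fin d) i I k))) x (basisVec i) =
      Real.sqrt |(g x).det| * β (fun k => dualVec g x (I k))) :
    extDeriv (hodge g h α) x = hodge g h' (fun _ => (-1 : ℝ) ^ p • β) x := by
  set T : (Fin (p + 1) → Fin d) → Coord d → ℝ :=
    fun I y => Real.sqrt |(g y).det| * α y (fun k => dualVec g y (I k)) with hTdef
  set C : (Fin (p + 1) → Fin d) → Alt d q :=
    fun I => contract h (detForm d) (fun k => basisVec (I k)) with hC
  have hfun : hodge g h α =
      fun y => ∑ I, (((p + 1).factorial : ℝ)⁻¹ * T I y) • C I := by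
    funext y
    ext v
    rw [hodge_apply]
    simp only [ContinuousAlternatingMap.sum_apply, ContinuousAlternatingMap.smul_apply,
      smul_eq_mul, Finset.mul_sum, hTdef, hC]
    exact Finset.sum_congr rfl fun I _ => by ring
  have hfd : HasFDerivAt (hodge g h α)
      (∑ I, ((((p + 1).factorial : ℝ)⁻¹ • fderiv ℝ (T I) x).smulRight (C I))) x := by
    rw [hfun]
    refine HasFDerivAt.fun_sum fun I _ => ?_
    have h1 : HasFDerivAt (T I) (fderiv ℝ (T I) x) x := (hT I).hasFDerivAt
    exact (h1.const_mul (((p + 1).factorial : ℝ)⁻¹)).smul_const (C I)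
  -- the slot `m` of `T` can be moved to the front, so that the divergence `hβ` appears
  have hmain : ∀ v : Fin (q + 1) → Coord d, ∀ m : Fin (p + 1),
      ∑ I : Fin (p + 1) → Fin d, (-1 : ℝ) ^ (m : ℕ) * (fderiv ℝ (T I) x (basisVec (I m)) *
        contract h' (detForm d) (m.removeNth fun k => basisVec (I k)) v) =
      ∑ I : Fin p → Fin d, Real.sqrt |(g x).det| * β (fun k => dualVec g x (I k)) *
        contract h' (detForm d) (fun k => basisVec (I k)) v := by
    intro v m
    rw [← (Fin.insertNthEquiv (fun _ => Fin d) m).sum_comp, Fintype.sum_prod_type_right]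
    refine Finset.sum_congr rfl fun I _ => ?_
    rw [← hβ, Finset.sum_mul]
    refine Finset.sum_congr rfl fun i _ => ?_
    have hTm : T (m.insertNth (α := fun _ => Fin d) i I) = fun y => (-1 : ℝ) ^ (m : ℕ) *
        (Real.sqrt |(g y).det| *
          α y (fun k => dualVec g y (Fin.cons (α := fun _ => Fin d) i I k))) := by
      funext y
      simp only [hTdef, alt_insertNth (α y) m (dualVec g y)]
      ring
    have hr : (m.removeNth fun k => (basisVec (m.insertNth (α := fun _ => Fin d) i I k) : Coord d))
        = fun k => basisVec (I k) := by
      funext k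
      simp [Fin.removeNth_apply]
    have hsq : (-1 : ℝ) ^ (m : ℕ) * (-1) ^ (m : ℕ) = 1 := by rw [← mul_pow]; simp
    have he : (Fin.insertNthEquiv (fun _ => Fin d) m) (i, I) =
      m.insertNth (α := fun _ => Fin d) i I := rfl
    simp only [he, hr, Fin.insertNth_apply_same]
    rw [hTm, fderiv_const_mul (hT _), _root_.smul_apply, smul_eq_mul]
    simp only [← mul_assoc, hsq, one_mul]
  ext v
  rw [extDeriv, hfd.fderiv, ContinuousAlternatingMap.alternatizeUncurryFin_apply, hodge_apply]
  simp only [_root_.sum_apply, ContinuousLinearMap.smulRight_apply,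
    _root_.smul_apply, ContinuousAlternatingMap.sum_apply,
    ContinuousAlternatingMap.smul_apply, smul_eq_mul, zsmul_eq_mul]
  push_cast
  calc _ = ((p + 1).factorial : ℝ)⁻¹ * ∑ I, ∑ k : Fin (q + 1), (-1 : ℝ) ^ (k : ℕ) *
        (fderiv ℝ (T I) x (v k) * C I (k.removeNth v)) := by
        rw [Finset.sum_comm, Finset.mul_sum]
        refine Finset.sum_congr rfl fun k _ => ?_
        rw [Finset.mul_sum, Finset.mul_sum]
        exact Finset.sum_congr rfl fun I _ => by ring
    _ = ((p + 1).factorial : ℝ)⁻¹ * ((-1) ^ p * ∑ m : Fin (p + 1),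
          ∑ I : Fin p → Fin d, Real.sqrt |(g x).det| * β (fun k => dualVec g x (I k)) *
            contract h' (detForm d) (fun k => basisVec (I k)) v) := by
        simp only [hC, sum_removeNth_contract h h']
        rw [← Finset.mul_sum, Finset.sum_comm, Finset.sum_congr rfl fun m _ => hmain v m]
    _ = _ := by
        rw [Finset.sum_const, Finset.card_univ, Fintype.card_fin, nsmul_eq_mul,
          Nat.factorial_succ]
        have h1 : ((p + 1 : ℕ) : ℝ) ≠ 0 := by exact_mod_cast Nat.succ_ne_zero p
        have h2 : (p.factorial : ℝ) ≠ 0 := by exact_mod_cast Nat.factorial_ne_zero p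
        simp_rw [mul_assoc, ← Finset.mul_sum]
        push_cast at h1 ⊢
        field_simp

/-- The codifferential with the codegree `q` as a free parameter instead of a subtraction. -/
theorem codiff_eq {d p q : ℕ} (g : Metric d) (h : p + 1 + q = d) (h' : p + (q + 1) = d)
    (α : Form d (p + 1)) :
    codiff g α = (-1 : ℝ) ^ (p + 1) •
      hodgeInv (q := q + 1) g h' (extDeriv (hodge (q := q) g h α)) := by
  obtain rfl : q = d - (p + 1) := by omega
  rw [codiff, dif_pos (by omega)]

/-- The codifferential is minus the divergence: `δα = -β` if the components of `β` with raised
indices are `|g|^{-1/2} ∂_i (√|g| α^{i i_1 … i_p})`. -/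
theorem codiff_eq_neg {d p : ℕ} {g : Metric d} {α : Form d (p + 1)} {x : Coord d} {β : Alt d p}
    (hsymm : (g x).IsSymm) (hdet : (g x).det ≠ 0)
    (hT : ∀ I : Fin (p + 1) → Fin d, DifferentiableAt ℝ
      (fun y => Real.sqrt |(g y).det| * α y (fun k => dualVec g y (I k))) x)
    (hβ : ∀ I : Fin p → Fin d, ∑ i, fderiv ℝ (fun y => Real.sqrt |(g y).det| *
        α y (fun k => dualVec g y (Fin.cons (α := fun _ => Fin d) i I k))) x (basisVec i) =
      Real.sqrt |(g x).det| * β (fun k => dualVec g x (I k))) :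
    codiff g α x = -β := by
  by_cases hp : p + 1 ≤ d
  · obtain ⟨q, h⟩ := Nat.exists_eq_add_of_le hp
    have h' : p + (q + 1) = d := by omega
    have h1 : hodgeInv g h' (extDeriv (hodge g h.symm α)) x = (-1 : ℝ) ^ p • β := by
      rw [← hodgeInv_hodge h' (fun _ => (-1 : ℝ) ^ p • β) hsymm hdet]
      simp only [hodgeInv, hodge, extDeriv_hodge h.symm h' hT hβ]
    rw [codiff_eq g h.symm h', Pi.smul_apply, h1, smul_smul, ← pow_add,
      show p + 1 + p = 2 * p + 1 by ring, pow_succ, (even_two_mul p).neg_one_pow]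
    rw [one_mul]
    exact neg_one_smul ℝ β
  · have hα : ∀ y, α y = 0 := fun y => alt_eq_zero_of_lt (by omega) _
    have : β = 0 := by
      refine alt_ext_rows (G := (g x)⁻¹) ?_ fun I _ => ?_
      · rw [Matrix.det_nonsing_inv]
        exact (isUnit_iff_ne_zero.2 hdet).ringInverse
      · have h1 := hβ I
        have h2 : Real.sqrt |(g x).det| ≠ 0 := Real.sqrt_ne_zero'.2 (abs_pos.2 hdet)
        have h3 : β (fun k => dualVec g x (I k)) = 0 := by simpa [hα, h2] using h1.symm
        exact h3
    rw [codiff, dif_neg hp, this]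
    simp

/-! ### Flat space, and derivatives of determinants -/

/-- For the flat metric `δF = -η^{AB} i_{∂_A} ∂_B F`. -/
theorem codiff_flatMetric {d p : ℕ} {σ : Fin d → ℝ} (hσ : ∀ A, σ A * σ A = 1)
    {F : Form d (p + 1)} {y : Coord d} (hF : DifferentiableAt ℝ F y) :
    codiff (flatMetric σ) F y =
      -∑ A, σ A • (fderiv ℝ F y (basisVec A)).curryLeft (basisVec A) := by
  have hdet : (Matrix.diagonal σ).det ≠ 0 := by
    rw [Matrix.det_diagonal]
    exact Finset.prod_ne_zero_iff.2 fun A _ h => by simpa [h] using hσ A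
  have hinv : (Matrix.diagonal σ)⁻¹ = Matrix.diagonal σ := by
    refine Matrix.inv_eq_left_inv ?_
    rw [Matrix.diagonal_mul_diagonal]
    simp [hσ]
  have hdual : ∀ z i, dualVec (flatMetric σ) z i = σ i • basisVec i := by
    intro z i
    rw [dualVec, flatMetric, hinv]
    ext j
    rcases eq_or_ne i j with rfl | h
    · simp [basisVec]
    · simp [basisVec, h, h.symm]
  refine codiff_eq_neg (Matrix.isSymm_diagonal σ) hdet (fun I => ?_) fun I => ?_
  · simp only [hdual, flatMetric]
    exact (hF.continuousAlternatingMap_apply fun k => differentiableAt_const _).const_mul _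
  · simp only [hdual, flatMetric]
    rw [ContinuousAlternatingMap.sum_apply, Finset.mul_sum]
    refine Finset.sum_congr rfl fun i _ => ?_
    rw [fderiv_const_mul (hF.continuousAlternatingMap_apply fun k => differentiableAt_const _),
      _root_.smul_apply, smul_eq_mul, fderiv_continuousAlternatingMap_apply_const_apply hF]
    congr 1
    rw [ContinuousAlternatingMap.smul_apply, ContinuousAlternatingMap.curryLeft_apply_apply]
    have h1 : (fun k => σ (Fin.cons (α := fun _ => Fin d) i I k) •
        (basisVec (Fin.cons (α := fun _ => Fin d) i I k) : Coord d)) =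
        Matrix.vecCons (σ i • basisVec i) (fun k => σ (I k) • basisVec (I k)) := by
      funext k
      refine Fin.cases ?_ (fun j => ?_) k <;> simp
    rw [h1]
    exact (fderiv ℝ F y (basisVec i)).toAlternatingMap.map_vecCons_smul _ _ _

/-- In the flat coordinates `i_D d i_D F` is `i_D ∂_D F + (p + 1) i_D F` for a `(p + 1)`-form `F`.
The second term comes from the derivatives of `D`; a derivative of `F` along another direction
than `D` would have `D` in two slots. -/
theorem interiorProd_extDeriv_interiorProd {d p : ℕ} {F : Form d (p + 1)} {y : Coord d}
    (hF : DifferentiableAt ℝ F y) :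
    interiorProd dilation (extDeriv (interiorProd dilation F)) y =
      (fderiv ℝ F y y).curryLeft y + ((p : ℝ) + 1) • interiorProd dilation F y := by
  let C := (ContinuousAlternatingMap.curryLeftLI (𝕜 := ℝ) (E := Coord d) (F := ℝ)
    (n := p)).toContinuousLinearMap
  have h1 : HasFDerivAt (fun z => C (F z)) (C ∘L fderiv ℝ F y) y :=
    HasFDerivAt.comp (g := C) y C.hasFDerivAt hF.hasFDerivAt
  have h2 := h1.clm_apply (hasFDerivAt_id y)
  have h3 : extDeriv (interiorProd dilation F) y = _ :=
    congrArg ContinuousAlternatingMap.alternatizeUncurryFin h2.fderiv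
  rw [interiorProd, h3, ContinuousAlternatingMap.alternatizeUncurryFin_add]
  have h4 : ContinuousAlternatingMap.alternatizeUncurryFin
      (C (F y) ∘L ContinuousLinearMap.id ℝ (Coord d)) = (p + 1) • F y := by
    rw [ContinuousLinearMap.comp_id]
    exact ContinuousAlternatingMap.alternatizeUncurryFin_curryLeft (F y)
  rw [id, h4, ContinuousAlternatingMap.curryLeft_add, add_comm, _root_.add_apply]
  congr 1
  · ext v
    rw [ContinuousAlternatingMap.curryLeft_apply_apply,
      ContinuousAlternatingMap.alternatizeUncurryFin_apply, Fin.sum_univ_succ,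
      Finset.sum_eq_zero, add_zero]
    · simp [dilation]
      rfl
    · intro k _
      rcases p with _ | p
      · exact k.elim0
      refine smul_eq_zero_of_right _ ?_
      change (fderiv ℝ F y (v k)) (Matrix.vecCons y
        (k.succ.removeNth (Matrix.vecCons y v : Fin (p + 1 + 1) → Coord d))) = 0
      refine ContinuousAlternatingMap.map_eq_zero_of_eq _ _ (i := 0) (j := 1) ?_ Fin.zero_ne_one
      have h5 : k.succ.succAbove 0 = 0 := Fin.succAbove_ne_zero_zero (Fin.succ_ne_zero k)
      have h6 : (Matrix.vecCons y (k.succ.removeNth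
          (Matrix.vecCons y v : Fin (p + 1 + 1) → Coord d)) : Fin (p + 2) → Coord d) 1 = y := by
        change (Matrix.vecCons y v : Fin (p + 1 + 1) → Coord d) (k.succ.succAbove 0) = y
        rw [h5]
        rfl
      rw [h6]
      rfl
  · ext v
    simp [interiorProd]

theorem alt_cons_update_swap {d p : ℕ} (A : Alt d (p + 1)) (a b : Coord d) (v : Fin p → Coord d)
    (m : Fin p) :
    A (Matrix.vecCons a (Function.update v m b)) =
      -A (Matrix.vecCons b (Function.update v m a)) := by
  have h := A.toAlternatingMap.map_swap (Matrix.vecCons b (Function.update v m a))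
    (i := 0) (j := m.succ) (Fin.succ_ne_zero m).symm
  refine Eq.trans ?_ h
  refine congrArg A (funext fun k => ?_)
  refine Fin.cases ?_ (fun j => ?_) k
  · simp
  · rcases eq_or_ne j m with rfl | hj
    · simp
    · have : Equiv.swap 0 m.succ j.succ = j.succ :=
        Equiv.swap_apply_of_ne_of_ne (Fin.succ_ne_zero j) (by simpa using hj)
      simp [this, hj]

section det

variable {E : Type*} [NormedAddCommGroup E] [NormedSpace ℝ E]

theorem differentiableAt_det {d : ℕ} {M : E → Matrix (Fin d) (Fin d) ℝ} {x : E}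
    (hM : ∀ i j, DifferentiableAt ℝ (fun y => M y i j) x) :
    DifferentiableAt ℝ (fun y => (M y).det) x := by
  have hrow : ∀ i, DifferentiableAt ℝ (fun y => (M y).row i) x :=
    fun i => differentiableAt_pi.2 (hM i)
  exact (differentiableAt_const (detForm d)).continuousAlternatingMap_apply hrow

theorem differentiableAt_inv_apply {d : ℕ} {M : E → Matrix (Fin d) (Fin d) ℝ} {x : E}
    (hM : ∀ i j, DifferentiableAt ℝ (fun y => M y i j) x) (hdet : (M x).det ≠ 0) (i j : Fin d) :
    DifferentiableAt ℝ (fun y => (M y)⁻¹ i j) x := by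
  simp_rw [Matrix.inv_def, Matrix.smul_apply, Ring.inverse_eq_inv, smul_eq_mul,
    Matrix.adjugate_apply]
  refine ((differentiableAt_det hM).inv hdet).mul (differentiableAt_det fun k l => ?_)
  rcases eq_or_ne k j with rfl | h
  · simp
  · simpa [Matrix.updateRow_ne h] using hM k l

/-- Jacobi's formula. -/
theorem fderiv_det {d : ℕ} {M : E → Matrix (Fin d) (Fin d) ℝ} {x : E}
    (hM : ∀ i j, DifferentiableAt ℝ (fun y => M y i j) x) (hdet : (M x).det ≠ 0) (w : E) :
    fderiv ℝ (fun y => (M y).det) x w =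
      (M x).det * ∑ i, ∑ j, (M x)⁻¹ j i * fderiv ℝ (fun y => M y i j) x w := by
  have hrow : ∀ i, DifferentiableAt ℝ (fun y => (M y).row i) x :=
    fun i => differentiableAt_pi.2 (hM i)
  have h1 := fderiv_continuousAlternatingMap_apply_apply
    (differentiableAt_const (x := x) (detForm d)) hrow w
  have h2 : (fun y => detForm d (fun i => (M y).row i)) = fun y => (M y).det := rfl
  rw [h2] at h1
  rw [h1, Finset.mul_sum]
  have h5 : fderiv ℝ (fun _ : E => detForm d) x w = 0 := by
    rw [fderiv_fun_const]
    rfl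
  rw [h5, show (0 : Alt d d) (fun i => (M x).row i) = 0 from rfl, zero_add]
  refine Finset.sum_congr rfl fun i _ => ?_
  have h3 : detForm d (Function.update (fun i => (M x).row i) i
      (fderiv ℝ (fun y => (M y).row i) x w)) =
      ((M x).updateRow i (fderiv ℝ (fun y => (M y).row i) x w)).det := rfl
  rw [h3, ← Matrix.cramer_transpose_apply, Matrix.cramer_eq_adjugate_mulVec,
    ← Matrix.adjugate_transpose, Matrix.mulVec, dotProduct, Finset.mul_sum]
  refine Finset.sum_congr rfl fun j _ => ?_
  have h4 : fderiv ℝ (fun y => (M y).row i) x w j = fderiv ℝ (fun y => M y i j) x w := by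
    have h7 : HasFDerivAt (fun y => M y i j) _ x := (hasFDerivAt_pi'.1 (hrow i).hasFDerivAt) j
    rw [h7.fderiv]
    rfl
  have h6 : (M x)⁻¹ j i = (M x).det⁻¹ * (M x).adjugate j i := by
    rw [Matrix.inv_def, Matrix.smul_apply, Ring.inverse_eq_inv, smul_eq_mul]
  rw [h4, h6, Matrix.transpose_apply]
  field_simp

/-- The derivative `(√|f|)' = (√|f| / 2f) f'`, for either sign of `f`. -/
theorem hasFDerivAt_sqrt_abs {f : E → ℝ} {f' : E →L[ℝ] ℝ} {x : E} (hf : HasFDerivAt f f' x)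
    (hx : f x ≠ 0) :
    HasFDerivAt (fun y => Real.sqrt |f y|) ((Real.sqrt |f x| / (2 * f x)) • f') x := by
  have h0 : |f x| ≠ 0 := abs_ne_zero.2 hx
  have h1 := ((hasDerivAt_abs hx).sqrt h0).comp_hasFDerivAt x hf
  have h6 : Real.sqrt |f x| / (2 * f x) = SignType.sign (f x) / (2 * Real.sqrt |f x|) := ?_
  · rw [h6]
    exact h1
  have h2 : Real.sqrt |f x| ≠ 0 := Real.sqrt_ne_zero'.2 (abs_pos.2 hx)
  have h3 : Real.sqrt |f x| * Real.sqrt |f x| = |f x| := Real.mul_self_sqrt (abs_nonneg _)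
  have h4 : (SignType.sign (f x) : ℝ) * f x = |f x| := sign_mul_self _
  rw [div_eq_div_iff (by simpa using hx) (by simpa using h2)]
  linear_combination 2 * h3 - 2 * h4

end det

/-! ### Frames on the pseudo-sphere -/

/-- The flat metric `η = diag(σ)` as a bilinear form. -/
def flatForm {d : ℕ} (σ : Fin d → ℝ) : Coord d →L[ℝ] Coord d →L[ℝ] ℝ :=
  ∑ A, σ A • (ContinuousLinearMap.proj (R := ℝ) (φ := fun _ : Fin d => ℝ) A).smulRight
    (ContinuousLinearMap.proj (R := ℝ) (φ := fun _ : Fin d => ℝ) A)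

theorem flatForm_apply {d : ℕ} (σ : Fin d → ℝ) (X Y : Coord d) :
    flatForm σ X Y = ∑ A, σ A * (X A * Y A) := by
  simp [flatForm]

theorem flatForm_comm {d : ℕ} (σ : Fin d → ℝ) (X Y : Coord d) :
    flatForm σ X Y = flatForm σ Y X := by
  simp only [flatForm_apply]
  exact Finset.sum_congr rfl fun A _ => by ring

theorem flatForm_basisVec {d : ℕ} (σ : Fin d → ℝ) (X : Coord d) (A : Fin d) :
    flatForm σ X (basisVec A) = σ A * X A := by
  simp [flatForm_apply, basisVec, Pi.single_apply]

theorem fderiv_flatForm {d m : ℕ} (σ : Fin d → ℝ) {f g : Coord m → Coord d} {x : Coord m}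
    (hf : DifferentiableAt ℝ f x) (hg : DifferentiableAt ℝ g x) (w : Coord m) :
    fderiv ℝ (fun y => flatForm σ (f y) (g y)) x w =
      flatForm σ (fderiv ℝ f x w) (g x) + flatForm σ (f x) (fderiv ℝ g x w) := by
  rw [((flatForm σ).hasFDerivAt_of_bilinear hf.hasFDerivAt hg.hasFDerivAt).fderiv]
  simp [add_comm]

theorem pullbackMetric_flatMetric_apply {m d : ℕ} (σ : Fin d → ℝ) (ψ : Coord m → Coord d)
    (x : Coord m) (i j : Fin m) :
    pullbackMetric ψ (flatMetric σ) x i j =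
      flatForm σ (fderiv ℝ ψ x (basisVec i)) (fderiv ℝ ψ x (basisVec j)) := by
  simp only [pullbackMetric, flatMetric, Matrix.of_apply, flatForm_apply, dotProduct,
    Matrix.mulVec_diagonal]
  exact Finset.sum_congr rfl fun A _ => by ring

/-- The tangent vectors `E^i = g^{ij} ∂_j ψ` of the image of `ψ`, dual to the coordinate vectors
`∂_i ψ` with respect to the metric induced by `η = diag(σ)`. -/
def dualFrame {m d : ℕ} (σ : Fin d → ℝ) (ψ : Coord m → Coord d) (x : Coord m) (i : Fin m) :
    Coord d :=
  fderiv ℝ ψ x (dualVec (pullbackMetric ψ (flatMetric σ)) x i)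

theorem dualFrame_eq_sum {m d : ℕ} (σ : Fin d → ℝ) (ψ : Coord m → Coord d) (x : Coord m)
    (i : Fin m) : dualFrame σ ψ x i =
      ∑ j, (pullbackMetric ψ (flatMetric σ) x)⁻¹ i j • fderiv ℝ ψ x (basisVec j) := by
  rw [dualFrame, eq_sum_basisVec (dualVec _ x i), map_sum]
  simp only [map_smul]
  rfl

/-- The Christoffel symbols `Γ^i_{jk} = η(E^i, ∂_k ∂_j ψ)` of the induced metric. -/
def christoffel {m d : ℕ} (σ : Fin d → ℝ) (ψ : Coord m → Coord d) (x : Coord m) (i j k : Fin m) :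
    ℝ :=
  flatForm σ (dualFrame σ ψ x i) (fderiv ℝ (fderiv ℝ ψ) x (basisVec k) (basisVec j))

namespace IsLocalParametrization

variable {n : ℕ} {σ : Fin (n + 1) → ℝ} {ε H : ℝ} {U : Set (Coord n)}
  {ψ : Coord n → Coord (n + 1)} {u : Coord n}

theorem contDiffAt (hψ : IsLocalParametrization σ ε H U ψ) (hu : u ∈ U) : ContDiffAt ℝ ∞ ψ u :=
  hψ.smooth.contDiffAt (hψ.isOpen.mem_nhds hu)

theorem differentiableAt (hψ : IsLocalParametrization σ ε H U ψ) (hu : u ∈ U) :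
    DifferentiableAt ℝ ψ u :=
  (hψ.contDiffAt hu).differentiableAt (by simp)

theorem differentiableAt_fderiv (hψ : IsLocalParametrization σ ε H U ψ) (hu : u ∈ U) :
    DifferentiableAt ℝ (fderiv ℝ ψ) u :=
  ((hψ.contDiffAt hu).fderiv_right (m := 1) (by norm_cast)).differentiableAt (by simp)

theorem differentiableAt_fderiv_apply (hψ : IsLocalParametrization σ ε H U ψ) (hu : u ∈ U)
    (v : Coord n) : DifferentiableAt ℝ (fun x => fderiv ℝ ψ x v) u :=
  (hψ.differentiableAt_fderiv hu).clm_apply (differentiableAt_const v)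

theorem fderiv_fderiv_apply (hψ : IsLocalParametrization σ ε H U ψ) (hu : u ∈ U)
    (v w : Coord n) :
    fderiv ℝ (fun x => fderiv ℝ ψ x v) u w = fderiv ℝ (fderiv ℝ ψ) u w v := by
  rw [fderiv_clm_apply (hψ.differentiableAt_fderiv hu) (differentiableAt_const v)]
  simp

theorem fderiv_fderiv_comm (hψ : IsLocalParametrization σ ε H U ψ) (hu : u ∈ U)
    (v w : Coord n) :
    fderiv ℝ (fderiv ℝ ψ) u v w = fderiv ℝ (fderiv ℝ ψ) u w v :=
  ((hψ.contDiffAt hu).isSymmSndFDerivAt (by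
    rw [minSmoothness_of_isRCLikeNormedField]
    exact WithTop.coe_le_coe.2 le_top)).eq v w

theorem flatForm_self (hψ : IsLocalParametrization σ ε H U ψ) (hu : u ∈ U) :
    flatForm σ (ψ u) (ψ u) = -ε * H⁻¹ ^ 2 := by
  rw [flatForm_apply, ← show _ = _ from hψ.mem u hu]
  exact Finset.sum_congr rfl fun A _ => by ring

/-- The position vector is normal to the pseudo-sphere. -/
theorem flatForm_fderiv_self (hψ : IsLocalParametrization σ ε H U ψ) (hu : u ∈ U)
    (v : Coord n) : flatForm σ (fderiv ℝ ψ u v) (ψ u) = 0 := by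
  have h1 : (fun x => flatForm σ (ψ x) (ψ x)) =ᶠ[𝓝 u] fun _ => -ε * H⁻¹ ^ 2 := by
    filter_upwards [hψ.isOpen.mem_nhds hu] with x hx using hψ.flatForm_self hx
  have h2 := fderiv_flatForm σ (hψ.differentiableAt hu) (hψ.differentiableAt hu) v
  rw [h1.fderiv_eq, flatForm_comm σ (ψ u)] at h2
  simp at h2
  linarith

/-- The vectors `ψ, ∂_1 ψ, …, ∂_n ψ` span the ambient space, since `ψ` is normal to the others and
not null. As `η` is nondegenerate, a vector orthogonal to all of them vanishes. -/
theorem eq_zero_of_flatForm_eq_zero (hψ : IsLocalParametrization σ ε H U ψ)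
    (hσ : ∀ A, σ A * σ A = 1) (hε : ε * ε = 1) (hH : H ≠ 0) (hu : u ∈ U) {X : Coord (n + 1)}
    (h0 : flatForm σ X (ψ u) = 0)
    (h1 : ∀ j, flatForm σ X (fderiv ℝ ψ u (basisVec j)) = 0) : X = 0 := by
  have h1' : ∀ v, flatForm σ X (fderiv ℝ ψ u v) = 0 := by
    intro v
    rw [eq_sum_basisVec v, map_sum, map_sum]
    exact Finset.sum_eq_zero fun j _ => by rw [map_smul, map_smul, h1, smul_zero]
  let L : Coord n × ℝ →ₗ[ℝ] Coord (n + 1) :=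
    (fderiv ℝ ψ u : Coord n →ₗ[ℝ] Coord (n + 1)).coprod (LinearMap.toSpanSingleton ℝ _ (ψ u))
  have hL : ∀ v t, L (v, t) = fderiv ℝ ψ u v + t • ψ u := fun v t => by simp [L]
  have hinj : Function.Injective L := by
    rw [injective_iff_map_eq_zero]
    rintro ⟨v, t⟩ hvt
    rw [hL] at hvt
    have h2 := congrArg (fun Z => flatForm σ Z (ψ u)) hvt
    simp only [map_add, map_smul, _root_.add_apply, _root_.smul_apply, map_zero,
      hψ.flatForm_fderiv_self hu, hψ.flatForm_self hu, zero_apply] at h2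
    have hε' : ε ≠ 0 := by rintro rfl; simp at hε
    have ht : t = 0 := by simpa [hε', hH] using h2
    rw [ht, zero_smul, add_zero] at hvt
    have hv : v = 0 := hψ.immersion u hu (by rw [hvt, map_zero])
    simp [hv, ht]
  have hsurj : Function.Surjective L := by
    refine (LinearMap.injective_iff_surjective_of_finrank_eq_finrank ?_).1 hinj
    simp
  funext A
  obtain ⟨⟨v, t⟩, hvt⟩ := hsurj (basisVec A)
  have h2 := flatForm_basisVec σ X A
  rw [← hvt, hL, map_add, map_smul, h1', h0] at h2
  have h3 : σ A ≠ 0 := fun h => by simpa [h] using hσ A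
  simpa [h3] using h2.symm

theorem isSymm_pullbackMetric (x : Coord n) : (pullbackMetric ψ (flatMetric σ) x).IsSymm := by
  refine Matrix.IsSymm.ext fun i j => ?_
  rw [pullbackMetric_flatMetric_apply, pullbackMetric_flatMetric_apply, flatForm_comm]

theorem det_pullbackMetric_ne_zero (hψ : IsLocalParametrization σ ε H U ψ)
    (hσ : ∀ A, σ A * σ A = 1) (hε : ε * ε = 1) (hH : H ≠ 0) (hu : u ∈ U) :
    (pullbackMetric ψ (flatMetric σ) u).det ≠ 0 := by
  intro hdet
  obtain ⟨v, hv, hgv⟩ := Matrix.exists_mulVec_eq_zero_iff.2 hdet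
  refine hv (hψ.immersion u hu ?_)
  rw [map_zero]
  refine hψ.eq_zero_of_flatForm_eq_zero hσ hε hH hu (hψ.flatForm_fderiv_self hu v) fun j => ?_
  have h1 := congrFun hgv j
  rw [eq_sum_basisVec v, map_sum, map_sum, _root_.sum_apply]
  simp only [Matrix.mulVec, dotProduct, pullbackMetric_flatMetric_apply, Pi.zero_apply] at h1
  rw [← h1]
  refine Finset.sum_congr rfl fun i _ => ?_
  rw [map_smul, map_smul, _root_.smul_apply, flatForm_comm, smul_eq_mul, mul_comm]

theorem flatForm_dualFrame_self (hψ : IsLocalParametrization σ ε H U ψ) (hu : u ∈ U) (i : Fin n) :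
    flatForm σ (dualFrame σ ψ u i) (ψ u) = 0 := hψ.flatForm_fderiv_self hu _

theorem flatForm_dualFrame_fderiv (hψ : IsLocalParametrization σ ε H U ψ)
    (hσ : ∀ A, σ A * σ A = 1) (hε : ε * ε = 1) (hH : H ≠ 0) (hu : u ∈ U) (i j : Fin n) :
    flatForm σ (dualFrame σ ψ u i) (fderiv ℝ ψ u (basisVec j)) = if i = j then 1 else 0 := by
  have hdet := isUnit_iff_ne_zero.2 (hψ.det_pullbackMetric_ne_zero hσ hε hH hu)
  have h1 : ((pullbackMetric ψ (flatMetric σ) u)⁻¹ * pullbackMetric ψ (flatMetric σ) u) i j =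
      (1 : Matrix (Fin n) (Fin n) ℝ) i j := by rw [Matrix.nonsing_inv_mul _ hdet]
  rw [Matrix.mul_apply, Matrix.one_apply] at h1
  rw [← h1, dualFrame_eq_sum, map_sum, _root_.sum_apply]
  refine Finset.sum_congr rfl fun k _ => ?_
  rw [map_smul, _root_.smul_apply, smul_eq_mul, pullbackMetric_flatMetric_apply]

theorem differentiableAt_pullbackMetric_apply (hψ : IsLocalParametrization σ ε H U ψ) (hu : u ∈ U)
    (i j : Fin n) :
    DifferentiableAt ℝ (fun x => pullbackMetric ψ (flatMetric σ) x i j) u := by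
  simp_rw [pullbackMetric_flatMetric_apply]
  exact ((flatForm σ).hasFDerivAt_of_bilinear
    (hψ.differentiableAt_fderiv_apply hu _).hasFDerivAt
    (hψ.differentiableAt_fderiv_apply hu _).hasFDerivAt).differentiableAt

theorem differentiableAt_dualFrame (hψ : IsLocalParametrization σ ε H U ψ)
    (hσ : ∀ A, σ A * σ A = 1) (hε : ε * ε = 1) (hH : H ≠ 0) (hu : u ∈ U) (i : Fin n) :
    DifferentiableAt ℝ (fun x => dualFrame σ ψ x i) u := by
  simp_rw [dualFrame_eq_sum]
  exact DifferentiableAt.fun_sum fun j _ =>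
    (differentiableAt_inv_apply (hψ.differentiableAt_pullbackMetric_apply hu)
      (hψ.det_pullbackMetric_ne_zero hσ hε hH hu) i j).smul
      (hψ.differentiableAt_fderiv_apply hu _)

theorem christoffel_symm (hψ : IsLocalParametrization σ ε H U ψ) (hu : u ∈ U) (i j k : Fin n) :
    christoffel σ ψ u i j k = christoffel σ ψ u i k j := by
  rw [christoffel, christoffel, hψ.fderiv_fderiv_comm hu]

/-- The derivatives `∂_k E^i = -Γ^i_{jk} E^j + ε H² δ^i_k ψ` of the dual frame, found by pairing
both sides with `ψ` and with the `∂_l ψ`. -/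
theorem fderiv_dualFrame (hψ : IsLocalParametrization σ ε H U ψ)
    (hσ : ∀ A, σ A * σ A = 1) (hε : ε * ε = 1) (hH : H ≠ 0) (hu : u ∈ U) (i k : Fin n) :
    fderiv ℝ (fun x => dualFrame σ ψ x i) u (basisVec k) =
      (if i = k then ε * H ^ 2 else 0) • ψ u -
        ∑ j, christoffel σ ψ u i j k • dualFrame σ ψ u j := by
  have hE := hψ.differentiableAt_dualFrame hσ hε hH hu i
  have h0 : flatForm σ (fderiv ℝ (fun x => dualFrame σ ψ x i) u (basisVec k)) (ψ u) =
      -if i = k then 1 else 0 := by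
    have h1 : (fun x => flatForm σ (dualFrame σ ψ x i) (ψ x)) =ᶠ[𝓝 u] fun _ => 0 := by
      filter_upwards [hψ.isOpen.mem_nhds hu] with x hx using hψ.flatForm_dualFrame_self hx i
    have h2 := fderiv_flatForm σ hE (hψ.differentiableAt hu) (basisVec k)
    rw [h1.fderiv_eq, hψ.flatForm_dualFrame_fderiv hσ hε hH hu] at h2
    simp only [fderiv_fun_const, Pi.zero_apply, zero_apply] at h2
    linarith
  have h1 : ∀ l, flatForm σ (fderiv ℝ (fun x => dualFrame σ ψ x i) u (basisVec k))
      (fderiv ℝ ψ u (basisVec l)) = -christoffel σ ψ u i l k := by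
    intro l
    have h1 : (fun x => flatForm σ (dualFrame σ ψ x i) (fderiv ℝ ψ x (basisVec l))) =ᶠ[𝓝 u]
        fun _ => if i = l then 1 else 0 := by
      filter_upwards [hψ.isOpen.mem_nhds hu] with x hx using
        hψ.flatForm_dualFrame_fderiv hσ hε hH hx i l
    have h2 := fderiv_flatForm σ hE (hψ.differentiableAt_fderiv_apply hu (basisVec l)) (basisVec k)
    rw [h1.fderiv_eq, hψ.fderiv_fderiv_apply hu] at h2
    simp only [fderiv_fun_const, Pi.zero_apply, zero_apply] at h2
    rw [christoffel]
    linarith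
  rw [← sub_eq_zero]
  refine hψ.eq_zero_of_flatForm_eq_zero hσ hε hH hu ?_ fun l => ?_
  · simp only [map_sub, map_sum, map_smul, _root_.sub_apply, _root_.sum_apply,
      _root_.smul_apply, h0,
      hψ.flatForm_self hu, hψ.flatForm_dualFrame_self hu, smul_eq_mul, mul_zero,
      Finset.sum_const_zero, sub_zero]
    split_ifs
    · have : ε * H ^ 2 * (-ε * H⁻¹ ^ 2) = -(ε * ε) := by field_simp
      rw [this, hε]
      ring
    · ring
  · simp only [map_sub, map_sum, map_smul, _root_.sub_apply, _root_.sum_apply,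
      _root_.smul_apply, h1,
      flatForm_comm σ (ψ u), hψ.flatForm_fderiv_self hu,
      hψ.flatForm_dualFrame_fderiv hσ hε hH hu, smul_eq_mul, mul_zero]
    simp

/-- The logarithmic derivative of the volume density is the trace of the connection. -/
theorem fderiv_sqrt_abs_det (hψ : IsLocalParametrization σ ε H U ψ)
    (hσ : ∀ A, σ A * σ A = 1) (hε : ε * ε = 1) (hH : H ≠ 0) (hu : u ∈ U) (k : Fin n) :
    fderiv ℝ (fun x => Real.sqrt |(pullbackMetric ψ (flatMetric σ) x).det|) u (basisVec k) =
      Real.sqrt |(pullbackMetric ψ (flatMetric σ) u).det| * ∑ i, christoffel σ ψ u i i k := by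
  have hdet := hψ.det_pullbackMetric_ne_zero hσ hε hH hu
  have hM := hψ.differentiableAt_pullbackMetric_apply hu
  rw [(hasFDerivAt_sqrt_abs (differentiableAt_det hM).hasFDerivAt hdet).fderiv,
    _root_.smul_apply, fderiv_det hM hdet]
  have h1 : ∀ i j, fderiv ℝ (fun x => pullbackMetric ψ (flatMetric σ) x i j) u (basisVec k) =
      flatForm σ (fderiv ℝ ψ u (basisVec j)) (fderiv ℝ (fderiv ℝ ψ) u (basisVec k) (basisVec i)) +
      flatForm σ (fderiv ℝ ψ u (basisVec i))
        (fderiv ℝ (fderiv ℝ ψ) u (basisVec k) (basisVec j)) := by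
    intro i j
    simp_rw [pullbackMetric_flatMetric_apply]
    rw [fderiv_flatForm σ (hψ.differentiableAt_fderiv_apply hu _)
      (hψ.differentiableAt_fderiv_apply hu _), hψ.fderiv_fderiv_apply hu,
      hψ.fderiv_fderiv_apply hu, flatForm_comm]
  have hs : ∀ i j, (pullbackMetric ψ (flatMetric σ) u)⁻¹ i j =
      (pullbackMetric ψ (flatMetric σ) u)⁻¹ j i := by
    intro i j
    have := (isSymm_pullbackMetric (ψ := ψ) (σ := σ) u).inv
    exact this.apply j i
  have h2 : ∀ i, ∑ j, (pullbackMetric ψ (flatMetric σ) u)⁻¹ i j *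
      flatForm σ (fderiv ℝ ψ u (basisVec j)) (fderiv ℝ (fderiv ℝ ψ) u (basisVec k) (basisVec i)) =
      christoffel σ ψ u i i k := by
    intro i
    rw [christoffel, dualFrame_eq_sum, map_sum, _root_.sum_apply]
    exact Finset.sum_congr rfl fun j _ => by rw [map_smul, _root_.smul_apply, smul_eq_mul]
  have h3 : ∑ i, ∑ j, (pullbackMetric ψ (flatMetric σ) u)⁻¹ j i *
      fderiv ℝ (fun x => pullbackMetric ψ (flatMetric σ) x i j) u (basisVec k) =
      2 * ∑ i, christoffel σ ψ u i i k := by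
    simp_rw [h1, mul_add, Finset.sum_add_distrib]
    rw [two_mul]
    congr 1
    · exact Finset.sum_congr rfl fun i _ => by simp_rw [hs _ i, h2]
    · rw [Finset.sum_comm]
      exact Finset.sum_congr rfl fun i _ => h2 i
  rw [h3, smul_eq_mul]
  field_simp

/-- Completeness of the frame: `∂_i ψ ⊗ E^i = η^{AB} ∂_A ⊗ ∂_B + ε H² ψ ⊗ ψ`, paired with a bilinear
form. -/
theorem sum_bilinear (hψ : IsLocalParametrization σ ε H U ψ)
    (hσ : ∀ A, σ A * σ A = 1) (hε : ε * ε = 1) (hH : H ≠ 0) (hu : u ∈ U)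
    (b : Coord (n + 1) →ₗ[ℝ] Coord (n + 1) →ₗ[ℝ] ℝ) :
    ∑ i, b (fderiv ℝ ψ u (basisVec i)) (dualFrame σ ψ u i) =
      ∑ A, σ A * b (basisVec A) (basisVec A) + ε * H ^ 2 * b (ψ u) (ψ u) := by
  -- the expansion of a vector in tangential and normal part
  have key : ∀ X : Coord (n + 1), X = ∑ i, flatForm σ X (fderiv ℝ ψ u (basisVec i)) •
      dualFrame σ ψ u i - (ε * H ^ 2 * flatForm σ X (ψ u)) • ψ u := by
    intro X
    rw [← sub_eq_zero]
    refine hψ.eq_zero_of_flatForm_eq_zero hσ hε hH hu ?_ fun l => ?_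
    · simp only [map_sub, map_sum, map_smul, _root_.sub_apply, _root_.sum_apply, _root_.smul_apply,
        hψ.flatForm_self hu, hψ.flatForm_dualFrame_self hu, smul_eq_mul, mul_zero,
        Finset.sum_const_zero, zero_sub]
      have : ε * H ^ 2 * flatForm σ X (ψ u) * (-ε * H⁻¹ ^ 2) =
          -(ε * ε) * flatForm σ X (ψ u) := by field_simp
      rw [this, hε]
      ring
    · simp only [map_sub, map_sum, map_smul, _root_.sub_apply, _root_.sum_apply, _root_.smul_apply,
        flatForm_comm σ (ψ u) (fderiv ℝ ψ u _), hψ.flatForm_fderiv_self hu,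
        hψ.flatForm_dualFrame_fderiv hσ hε hH hu, smul_eq_mul, mul_zero]
      simp
  have h1 : ∀ A, σ A * b (basisVec A) (basisVec A) =
      ∑ i, fderiv ℝ ψ u (basisVec i) A * b (basisVec A) (dualFrame σ ψ u i) -
        ε * H ^ 2 * (ψ u A * b (basisVec A) (ψ u)) := by
    intro A
    have hb := congrArg (b (basisVec A)) (key (basisVec A))
    simp only [map_sub, map_sum, map_smul, flatForm_comm σ (basisVec A), flatForm_basisVec,
      smul_eq_mul] at hb
    rw [hb, mul_sub, Finset.mul_sum]
    congr 1
    · exact Finset.sum_congr rfl fun i _ => by rw [← mul_assoc, ← mul_assoc, hσ, one_mul]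
    · linear_combination (ε * H ^ 2 * ψ u A * b (basisVec A) (ψ u)) * hσ A
  have h2 : ∀ X Y, b X Y = ∑ A, X A * b (basisVec A) Y := by
    intro X Y
    conv_lhs => rw [eq_sum_basisVec X]
    simp
  simp_rw [h1, Finset.sum_sub_distrib, ← Finset.mul_sum, ← h2]
  rw [Finset.sum_comm]
  simp_rw [← h2]
  ring

end IsLocalParametrization

/-! ### The codifferential on the pseudo-sphere -/

theorem cons_comp {d m p : ℕ} (f : Fin d → Coord m) (i : Fin d) (I : Fin p → Fin d) :
    (fun k => f (Fin.cons (α := fun _ => Fin d) i I k)) =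
      Matrix.vecCons (f i) (fun k => f (I k)) := by
  funext k
  refine Fin.cases ?_ (fun j => ?_) k <;> simp

namespace IsLocalParametrization

variable {n : ℕ} {σ : Fin (n + 1) → ℝ} {ε H : ℝ} {U : Set (Coord n)}
  {ψ : Coord n → Coord (n + 1)} {u : Coord n}

/-- When the derivative `∂_i` falls on another slot than the one contracted with it, the
tangential part of `∂_i E^{i_m}` drops out, as it is symmetric in indices in which `A` is
antisymmetric. The normal part replaces `E^{i_m}` by `ψ`, and an exchange of the two slots gives
the sign. -/
theorem sum_apply_update_fderiv_dualFrame (hψ : IsLocalParametrization σ ε H U ψ)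
    (hσ : ∀ A, σ A * σ A = 1) (hε : ε * ε = 1) (hH : H ≠ 0) (hu : u ∈ U) {p : ℕ}
    (A : Alt (n + 1) (p + 1)) (I : Fin p → Fin n) (m : Fin p) :
    ∑ i, A (Matrix.vecCons (dualFrame σ ψ u i) (Function.update (fun k => dualFrame σ ψ u (I k)) m
        (fderiv ℝ (fun x => dualFrame σ ψ x (I m)) u (basisVec i)))) =
      -(ε * H ^ 2) * A (Matrix.vecCons (ψ u) fun k => dualFrame σ ψ u (I k)) := by
  set E : Fin n → Coord (n + 1) := fun i => dualFrame σ ψ u i with hE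
  let B : Coord (n + 1) → Coord (n + 1) →ₗ[ℝ] ℝ := fun X =>
    (A.curryLeft X).toMultilinearMap.toLinearMap (fun k => E (I k)) m
  have hB : ∀ X Y, B X Y = A (Matrix.vecCons X (Function.update (fun k => E (I k)) m Y)) :=
    fun X Y => rfl
  have hanti : ∀ X Y, B X Y = -B Y X := fun X Y => by
    rw [hB, hB, alt_cons_update_swap]
  change ∑ i, B (E i) (fderiv ℝ (fun x => dualFrame σ ψ x (I m)) u (basisVec i)) = _
  have hzero : ∑ i, ∑ j, christoffel σ ψ u (I m) j i * B (E i) (E j) = 0 := by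
    have h1 : ∑ i, ∑ j, christoffel σ ψ u (I m) j i * B (E i) (E j) =
        -∑ i, ∑ j, christoffel σ ψ u (I m) j i * B (E i) (E j) := by
      conv_lhs => rw [Finset.sum_comm]
      rw [← Finset.sum_neg_distrib]
      refine Finset.sum_congr rfl fun i _ => ?_
      rw [← Finset.sum_neg_distrib]
      refine Finset.sum_congr rfl fun j _ => ?_
      rw [hψ.christoffel_symm hu, hanti, mul_neg]
    linarith
  have hself : B (E (I m)) (ψ u) = -A (Matrix.vecCons (ψ u) fun k => E (I k)) := by
    rw [hanti, hB, Function.update_eq_self]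
  simp_rw [hψ.fderiv_dualFrame hσ hε hH hu, map_sub, map_sum, map_smul, smul_eq_mul,
    Finset.sum_sub_distrib]
  rw [hzero, Finset.sum_eq_single (I m)]
  · rw [if_pos rfl, hself]
    ring
  · intro i _ hi
    rw [if_neg (Ne.symm hi), zero_mul]
  · simp

/-- The codifferential of a form pulled back to the pseudo-sphere:
`δ_Σ F_Σ = (δF - ε H² (i_D d i_D F + (n - 2p - 1) i_D F))_Σ` for a `(p + 1)`-form `F`. -/
theorem codiff_pullback (hψ : IsLocalParametrization σ ε H U ψ)
    (hσ : ∀ A, σ A * σ A = 1) (hε : ε * ε = 1) (hH : H ≠ 0) (hu : u ∈ U) {p : ℕ}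
    {F : Form (n + 1) (p + 1)} (hF : DifferentiableAt ℝ F (ψ u)) :
    codiff (pullbackMetric ψ (flatMetric σ)) (pullback ψ F) u =
      pullback ψ (codiff (flatMetric σ) F - (ε * H ^ 2) •
        (interiorProd dilation (extDeriv (interiorProd dilation F)) +
          ((n : ℝ) - 2 * p - 1) • interiorProd dilation F)) u := by
  have hdet := hψ.det_pullbackMetric_ne_zero hσ hε hH hu
  set g := pullbackMetric ψ (flatMetric σ) with hg
  set s : Coord n → ℝ := fun x => Real.sqrt |(g x).det| with hs
  have hsd : DifferentiableAt ℝ s u :=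
    (hasFDerivAt_sqrt_abs (differentiableAt_det
      (hψ.differentiableAt_pullbackMetric_apply hu)).hasFDerivAt hdet).differentiableAt
  have hEd := fun i => hψ.differentiableAt_dualFrame hσ hε hH hu i
  have hFd : DifferentiableAt ℝ (fun x => F (ψ x)) u := hF.comp u (hψ.differentiableAt hu)
  have hFE : ∀ J : Fin (p + 1) → Fin n, DifferentiableAt ℝ
      (fun x => F (ψ x) (fun k => dualFrame σ ψ x (J k))) u :=
    fun J => hFd.continuousAlternatingMap_apply fun k => hEd (J k)
  -- the ambient form whose pull-back is `-δ(ψ^* F)`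
  set G : Alt (n + 1) p := ∑ A, σ A • (fderiv ℝ F (ψ u) (basisVec A)).curryLeft (basisVec A) +
    (ε * H ^ 2) • ((fderiv ℝ F (ψ u) (ψ u)).curryLeft (ψ u) +
      ((n : ℝ) - p) • (F (ψ u)).curryLeft (ψ u)) with hG
  have hGF : (codiff (flatMetric σ) F - (ε * H ^ 2) •
        (interiorProd dilation (extDeriv (interiorProd dilation F)) +
          ((n : ℝ) - 2 * p - 1) • interiorProd dilation F)) (ψ u) = -G := by
    rw [Pi.sub_apply, Pi.smul_apply, Pi.add_apply, Pi.smul_apply, codiff_flatMetric hσ hF,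
      interiorProd_extDeriv_interiorProd hF, hG]
    simp only [interiorProd, dilation]
    module
  rw [pullback, hGF]
  have hneg : (-G).compContinuousLinearMap (fderiv ℝ ψ u) =
    -(G.compContinuousLinearMap (fderiv ℝ ψ u)) := rfl
  rw [hneg]
  refine codiff_eq_neg (isSymm_pullbackMetric u) hdet (fun J => hsd.mul (hFE J))
    fun I => ?_
  have hcons : ∀ x i, (fun k => dualFrame σ ψ x (Fin.cons (α := fun _ => Fin n) i I k)) =
    Matrix.vecCons (dualFrame σ ψ x i) (fun k => dualFrame σ ψ x (I k)) := fun x i =>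
      cons_comp _ i I
  -- the product rule for the `i`-th term of the divergence
  have hterm : ∀ i, fderiv ℝ (fun x => s x * pullback ψ F x
      (fun k => dualVec g x (Fin.cons (α := fun _ => Fin n) i I k))) u (basisVec i) =
      s u * ((∑ j, christoffel σ ψ u j j i) *
          F (ψ u) (Matrix.vecCons (dualFrame σ ψ u i) fun k => dualFrame σ ψ u (I k)) +
        fderiv ℝ F (ψ u) (fderiv ℝ ψ u (basisVec i))
          (Matrix.vecCons (dualFrame σ ψ u i) fun k => dualFrame σ ψ u (I k)) +
        (F (ψ u) (Matrix.vecCons (fderiv ℝ (fun x => dualFrame σ ψ x i) u (basisVec i))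
            fun k => dualFrame σ ψ u (I k)) +
          ∑ m, F (ψ u) (Matrix.vecCons (dualFrame σ ψ u i)
            (Function.update (fun k => dualFrame σ ψ u (I k)) m
              (fderiv ℝ (fun x => dualFrame σ ψ x (I m)) u (basisVec i)))))) := by
    intro i
    have h1 : (fun x => s x * pullback ψ F x
        (fun k => dualVec g x (Fin.cons (α := fun _ => Fin n) i I k))) =
        fun x => s x * F (ψ x) (fun k => dualFrame σ ψ x (Fin.cons (α := fun _ => Fin n) i I k)) :=
      rfl
    have h2 := fderiv_continuousAlternatingMap_apply_apply hFd
      (fun k : Fin (p + 1) => hEd (Fin.cons (α := fun _ => Fin n) i I k)) (basisVec i)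
    have h3 : fderiv ℝ (fun x => F (ψ x)) u (basisVec i) =
        fderiv ℝ F (ψ u) (fderiv ℝ ψ u (basisVec i)) := by
      have := fderiv_comp u hF (hψ.differentiableAt hu)
      exact congrArg (fun L => L (basisVec i)) this
    rw [h1, fderiv_fun_mul hsd (hFE _), _root_.add_apply, _root_.smul_apply,
      _root_.smul_apply, h2, h3, hs, hψ.fderiv_sqrt_abs_det hσ hε hH hu, Fin.sum_univ_succ, hcons]
    have h4 : ∀ X, Function.update (Matrix.vecCons (dualFrame σ ψ u i)
        fun k => dualFrame σ ψ u (I k)) 0 X = Matrix.vecCons X fun k => dualFrame σ ψ u (I k) :=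
      fun X => Fin.update_cons_zero _ _ _
    have h5 : ∀ (m : Fin p) X, Function.update (Matrix.vecCons (dualFrame σ ψ u i)
        fun k => dualFrame σ ψ u (I k)) m.succ X = Matrix.vecCons (dualFrame σ ψ u i)
          (Function.update (fun k => dualFrame σ ψ u (I k)) m X) :=
      fun m X => (Fin.cons_update _ _ _ _).symm
    simp only [h4, h5, Fin.cons_zero, Fin.cons_succ, smul_eq_mul]
    ring
  change ∑ i, fderiv ℝ (fun x => s x * pullback ψ F x
      (fun k => dualVec g x (Fin.cons (α := fun _ => Fin n) i I k))) u (basisVec i) =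
    s u * G (fun k => dualFrame σ ψ u (I k))
  simp_rw [hterm, ← Finset.mul_sum, Finset.sum_add_distrib]
  congr 1
  -- the contraction of the derivative of `F`
  have hcontr := hψ.sum_bilinear hσ hε hH hu (LinearMap.mk₂ ℝ (fun X Y => fderiv ℝ F (ψ u) X
    (Matrix.vecCons Y fun k => dualFrame σ ψ u (I k))) (by simp) (by simp)
    (fun X Y Z => (fderiv ℝ F (ψ u) X).toAlternatingMap.map_vecCons_add _ _ _)
    (fun c X Y => (fderiv ℝ F (ψ u) X).toAlternatingMap.map_vecCons_smul _ _ _))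
  simp only [LinearMap.mk₂_apply] at hcontr
  rw [hcontr]
  -- in the divergence the trace of the connection cancels against the derivative of `√|g|`
  let B : Coord (n + 1) →ₗ[ℝ] ℝ :=
    { toFun := fun X => F (ψ u) (Matrix.vecCons X fun k => dualFrame σ ψ u (I k))
      map_add' := fun X Y => (F (ψ u)).toAlternatingMap.map_vecCons_add _ _ _
      map_smul' := fun c X => (F (ψ u)).toAlternatingMap.map_vecCons_smul _ _ _ }
  have hB : ∀ X, F (ψ u) (Matrix.vecCons X fun k => dualFrame σ ψ u (I k)) = B X := fun X => rfl
  have htrace : ∑ i, B (fderiv ℝ (fun x => dualFrame σ ψ x i) u (basisVec i)) =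
      n * (ε * H ^ 2) * B (ψ u) - ∑ i, (∑ j, christoffel σ ψ u j j i) * B (dualFrame σ ψ u i) := by
    simp_rw [hψ.fderiv_dualFrame hσ hε hH hu, map_sub, map_sum, map_smul, smul_eq_mul,
      Finset.sum_sub_distrib, if_true]
    rw [Finset.sum_const, Finset.card_univ, Fintype.card_fin, nsmul_eq_mul, Finset.sum_comm]
    have h1 : ∀ j, ∑ i, christoffel σ ψ u i j i * B (dualFrame σ ψ u j) =
        (∑ i, christoffel σ ψ u i i j) * B (dualFrame σ ψ u j) := fun j => by
      rw [Finset.sum_mul]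
      exact Finset.sum_congr rfl fun i _ => by rw [hψ.christoffel_symm hu]
    simp_rw [h1]
    ring
  rw [Finset.sum_comm (f := fun i m => F (ψ u) (Matrix.vecCons (dualFrame σ ψ u i)
            (Function.update (fun k => dualFrame σ ψ u (I k)) m
              (fderiv ℝ (fun x => dualFrame σ ψ x (I m)) u (basisVec i)))))]
  simp_rw [hψ.sum_apply_update_fderiv_dualFrame hσ hε hH hu, hB, htrace]
  rw [Finset.sum_const, Finset.card_univ, Fintype.card_fin, nsmul_eq_mul, hG]
  simp only [ContinuousAlternatingMap.add_apply, ContinuousAlternatingMap.sum_apply,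
    ContinuousAlternatingMap.smul_apply, ContinuousAlternatingMap.curryLeft_apply_apply,
    smul_eq_mul, hB]
  ring

end IsLocalParametrization

/-! ### The Laplace-de Rham operator -/

theorem contDiffAt_extDeriv {d p : ℕ} {F : Form d p} {y : Coord d}
    (hF : ContDiffAt ℝ ∞ F y) : ContDiffAt ℝ ∞ (extDeriv F) y := by
  let C := ContinuousAlternatingMap.alternatizeUncurryFinCLM ℝ (Coord d) ℝ (n := p)
  have hC : ContDiff ℝ ∞ C := by fun_prop
  exact hC.contDiffAt.comp y (hF.fderiv_right (m := ∞) le_rfl)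

theorem contDiffAt_interiorProd {d p : ℕ} {F : Form d (p + 1)} {X : Coord d → Coord d}
    {y : Coord d} (hF : ContDiffAt ℝ ∞ F y) (hX : ContDiffAt ℝ ∞ X y) :
    ContDiffAt ℝ ∞ (interiorProd X F) y := by
  let C := (ContinuousAlternatingMap.curryLeftLI (𝕜 := ℝ) (E := Coord d) (F := ℝ)
    (n := p)).toContinuousLinearMap
  have hC : ContDiff ℝ ∞ C := by fun_prop
  exact (hC.contDiffAt.comp y hF).clm_apply hX

theorem contDiffAt_codiff_flatMetric {d p : ℕ} {σ : Fin d → ℝ} (hσ : ∀ A, σ A * σ A = 1)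
    {F : Form d (p + 1)} {y : Coord d} (hF : ContDiffAt ℝ ∞ F y) :
    ContDiffAt ℝ ∞ (codiff (flatMetric σ) F) y := by
  have h1 : codiff (flatMetric σ) F =ᶠ[𝓝 y] fun z =>
      -∑ A, σ A • (fderiv ℝ F z (basisVec A)).curryLeft (basisVec A) := by
    filter_upwards [(hF.of_le (m := 1) (by norm_cast)).eventually (by simp)] with z hz
    exact codiff_flatMetric hσ (hz.differentiableAt (by simp))
  refine ContDiffAt.congr_of_eventuallyEq ?_ h1
  refine (ContDiffAt.sum fun A _ => ContDiffAt.const_smul _ ?_).neg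
  exact contDiffAt_interiorProd (X := fun _ => basisVec A)
    ((hF.fderiv_right (m := ∞) le_rfl).clm_apply contDiffAt_const) contDiffAt_const

theorem codiff_congr {d p : ℕ} (g : Metric d) {α β : Form d (p + 1)} {x : Coord d}
    (h : α =ᶠ[𝓝 x] β) : codiff g α x = codiff g β x := by
  by_cases hp : p + 1 ≤ d
  · rw [codiff, codiff, dif_pos hp, dif_pos hp, Pi.smul_apply, Pi.smul_apply]
    congr 1
    have h1 : hodge (q := d - (p + 1)) g (by omega) α =ᶠ[𝓝 x] hodge g (by omega) β := by
      filter_upwards [h] with y hy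
      simp only [hodge, hy]
    simp only [hodgeInv, hodge, h1.extDeriv_eq]
  · rw [codiff, codiff, dif_neg hp, dif_neg hp]

theorem interiorProd_interiorProd {d p : ℕ} (X : Coord d → Coord d) (α : Form d (p + 2)) :
    interiorProd X (interiorProd X α) = 0 := by
  funext x
  exact ContinuousAlternatingMap.curryLeft_same _ _

theorem interiorProd_add {d p : ℕ} (X : Coord d → Coord d) (α β : Form d (p + 1)) :
    interiorProd X (α + β) = interiorProd X α + interiorProd X β := rfl

/-- `L_X² = i_X d i_X d + d i_X d i_X`, because `d² = 0` and `i_X² = 0`. -/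
theorem lieDeriv_lieDeriv {d p : ℕ} {X : Coord d → Coord d} {F : Form d (p + 1)} {y : Coord d}
    (hF : ContDiffAt ℝ ∞ F y) (hX : ContDiffAt ℝ ∞ X y) :
    lieDeriv X (lieDeriv X F) y =
      interiorProd X (extDeriv (interiorProd X (extDeriv F))) y +
        extDeriv (interiorProd X (extDeriv (interiorProd X F))) y := by
  have h1 : interiorProd X (lieDeriv X F) = interiorProd X (extDeriv (interiorProd X F)) := by
    rw [lieDeriv, interiorProd_add, interiorProd_interiorProd, zero_add]
  have h2 : extDeriv (lieDeriv X F) y = extDeriv (interiorProd X (extDeriv F)) y := by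
    rw [lieDeriv, extDeriv_add
      ((contDiffAt_interiorProd (contDiffAt_extDeriv hF) hX).differentiableAt (by simp))
      ((contDiffAt_extDeriv (contDiffAt_interiorProd hF hX)).differentiableAt (by simp)),
      extDeriv_extDeriv_apply (contDiffAt_interiorProd hF hX) (by
        rw [minSmoothness_of_isRCLikeNormedField]
        exact WithTop.coe_le_coe.2 le_top), add_zero]
  rw [lieDeriv, Pi.add_apply, h1]
  simp only [interiorProd, h2]

end DeRham
end

open DeRham in
theorem mainTheorem2 (n : ℕ) (σ : Fin (n + 1) → ℝ) (hσ : ∀ A, σ A = 1 ∨ σ A = -1)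
    (ε H : ℝ) (hε : ε = 1 ∨ ε = -1) (hH : 0 < H)
    (W : Set (Coord (n + 1))) (hW : IsOpen W)
    (a : Form (n + 1) 1) (ha : ContDiffOn ℝ ∞ a W)
    (U : Set (Coord n)) (ψ : Coord n → Coord (n + 1))
    (hψ : IsLocalParametrization σ ε H U ψ)
    (u : Coord n) (hu : u ∈ U) (huW : ψ u ∈ W) :
    pullback ψ (laplaceDeRham (flatMetric σ) a) u =
      laplaceDeRham (pullbackMetric ψ (flatMetric σ)) (pullback ψ a) u
        - (ε * H ^ 2) •
          pullback ψ
            (lieDeriv dilation (lieDeriv dilation a)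
              + ((n : ℝ) - 3) • lieDeriv dilation a
              + (2 : ℝ) • extDeriv (interiorProd dilation a)) u := by
  have hσ' : ∀ A, σ A * σ A = 1 := fun A => by rcases hσ A with h | h <;> rw [h] <;> norm_num
  have hε' : ε * ε = 1 := by rcases hε with h | h <;> rw [h] <;> norm_num
  have hD : ∀ y : Coord (n + 1), ContDiffAt ℝ ∞ dilation y := fun y => contDiffAt_id
  have haW : ∀ y ∈ W, ContDiffAt ℝ ∞ a y := fun y hy => ha.contDiffAt (hW.mem_nhds hy)
  have hay := haW _ huW
  have hr : minSmoothness ℝ 2 ≤ (∞ : WithTop ℕ∞) := by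
    rw [minSmoothness_of_isRCLikeNormedField]
    exact WithTop.coe_le_coe.2 le_top
  have hnear : ∀ᶠ x in nhds u, x ∈ U ∧ ψ x ∈ W :=
    (hψ.isOpen.eventually_mem hu).and
      ((hψ.differentiableAt hu).continuousAt (hW.mem_nhds huW))
  have hia := contDiffAt_interiorProd hay (hD _)
  have hidia := contDiffAt_interiorProd (contDiffAt_extDeriv hia) (hD _)
  -- `dδ` on the pseudo-sphere
  have h1 : codiff (pullbackMetric ψ (flatMetric σ)) (pullback ψ a) =ᶠ[nhds u]
      pullback ψ (codiff (flatMetric σ) a + (-(ε * H ^ 2)) •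
        (interiorProd dilation (extDeriv (interiorProd dilation a)) +
          ((n : ℝ) - 1) • interiorProd dilation a)) := by
    filter_upwards [hnear] with x hx
    rw [hψ.codiff_pullback hσ' hε' hH.ne' hx.1
      ((haW _ hx.2).differentiableAt (by simp))]
    ext v
    simp only [pullback, Pi.add_apply, Pi.smul_apply, Pi.sub_apply,
      ContinuousAlternatingMap.compContinuousLinearMap_apply,
      ContinuousAlternatingMap.add_apply, ContinuousAlternatingMap.sub_apply,
      ContinuousAlternatingMap.smul_apply, smul_eq_mul]
    push_cast
    ring
  have hc := (contDiffAt_codiff_flatMetric hσ' hay).differentiableAt (by simp)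
  have hd1 := hidia.differentiableAt (by simp)
  have hd2 : DifferentiableAt ℝ (((n : ℝ) - 1) • interiorProd dilation a) (ψ u) :=
    (hia.differentiableAt (by simp)).const_smul _
  have hd3 : DifferentiableAt ℝ ((-(ε * H ^ 2)) •
      (interiorProd dilation (extDeriv (interiorProd dilation a)) +
        ((n : ℝ) - 1) • interiorProd dilation a)) (ψ u) := (hd1.add hd2).const_smul _
  have h2 := h1.extDeriv_eq.trans (extDeriv_pullback (hc.add hd3) (hψ.contDiffAt hu) hr)
  rw [extDeriv_add hc hd3, extDeriv_smul, extDeriv_add hd1 hd2, extDeriv_smul] at h2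
  -- `δd` on the pseudo-sphere
  have h3 : extDeriv (pullback ψ a) =ᶠ[nhds u] pullback ψ (extDeriv a) := by
    filter_upwards [hnear] with x hx
    exact extDeriv_pullback ((haW _ hx.2).differentiableAt (by simp)) (hψ.contDiffAt hx.1) hr
  have h4 := (codiff_congr (pullbackMetric ψ (flatMetric σ)) h3).trans
    (hψ.codiff_pullback hσ' hε' hH.ne' hu ((contDiffAt_extDeriv hay).differentiableAt (by simp)))
  have h5 := lieDeriv_lieDeriv hay (hD _)
  ext v
  have h6 : laplaceDeRham (pullbackMetric ψ (flatMetric σ)) (pullback ψ a) u =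
    -(extDeriv (codiff (pullbackMetric ψ (flatMetric σ)) (pullback ψ a)) u +
      codiff (pullbackMetric ψ (flatMetric σ)) (extDeriv (pullback ψ a)) u) := rfl
  rw [h6, h2, h4]
  simp only [pullback, laplaceDeRham, Pi.add_apply, Pi.smul_apply, Pi.neg_apply, Pi.sub_apply, h5]
  simp only [lieDeriv, Pi.add_apply, ContinuousAlternatingMap.compContinuousLinearMap_apply,
    ContinuousAlternatingMap.add_apply, ContinuousAlternatingMap.sub_apply,
    ContinuousAlternatingMap.neg_apply, ContinuousAlternatingMap.smul_apply, smul_eq_mul]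
  push_cast
  ring
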